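/- For integers $0\le k\le n$ let $$\mathrm{Gr}(k,\mathbb{C}^n)=\{X\in\mathbb{C}^{n\times n} : X^{\mathsf H}X=I_n,\ X^2=I_n,\ \operatorname{tr}(X)=2k-n\}$$ be the involution model of the Grassmannian of $k$-dimensional complex subspaces of $\mathbb{C}^n$, and let $$\Phi(k,k',\mathbb{C}^n)=\{XY : X\in \mathrm{Gr}(k,\mathbb{C}^n),\ Y\in \mathrm{Gr}(k',\mathbb{C}^n)\}\subseteq \mathrm{U}(n)$$ be the set of matrix products. Regard $\mathbb{C}^{n\times n}$ as $\mathbb{R}^{2n^2}$ through the real and imaginary parts of the entries; $\Phi(k,k',\mathbb{C}^n)$ is a real semialgebraic set. The dimension $\dim S$ of a semialgebraic set $S\subseteq\mathbb{R}^N$ is the Krull dimension of $\mathbb{R}[x_1,\dots,x_N]/I(S)$, where $I(S)$ is the ideal of all real polynomials vanishing on $S$. Let $n,k,k'$ be non-negative integers with $k'\le k<n$ and $k+k'\le n$. Then $$\dim \Phi(k,k',\mathbb{C}^n)=2k(n-k)+2k'(n-k')-k'.$$ -/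

import Mathlib

open scoped Matrix

/-- The involution model of the Grassmannian of `k`-dimensional complex subspaces of `ℂⁿ`:
unitary `n × n` matrices `X` with `X² = I` and `tr X = 2k - n`. -/
def complexGrassmannian (k n : ℕ) : Set (Matrix (Fin n) (Fin n) ℂ) :=
  {X | X ∈ Matrix.unitaryGroup (Fin n) ℂ ∧ X ^ 2 = 1 ∧ X.trace = 2 * (k : ℂ) - (n : ℂ)}

/-- `Φ(k, k', ℂⁿ)`: the set of matrix products `X Y` with `X ∈ Gr(k, ℂⁿ)`, `Y ∈ Gr(k', ℂⁿ)`. -/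
def grassmannianProduct (k k' n : ℕ) : Set (Matrix (Fin n) (Fin n) ℂ) :=
  {Z | ∃ X ∈ complexGrassmannian k n, ∃ Y ∈ complexGrassmannian k' n, Z = X * Y}

/-- The dimension of a semialgebraic subset `S` of a real coordinate space `ℝ^σ`
(Bochnak, Coste and Roy, *Real Algebraic Geometry*, 2.8.1): the Krull dimension of the ring
`ℝ[x] / I(S)` of polynomial functions on `S`, where `I(S)` is the ideal of the real polynomials
that vanish on `S`. The empty set has dimension `⊥`. -/
noncomputable def semialgebraicDim {σ : Type*} (S : Set (σ → ℝ)) : WithBot ℕ∞ :=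
  ringKrullDim (MvPolynomial σ ℝ ⧸ MvPolynomial.vanishingIdeal ℝ S)

/-- The identification of `ℂ^{n × n}` with the real coordinate space `ℝ^{2n²}`, by the real and
the imaginary parts of the entries. -/
def realCoords {n : ℕ} (A : Matrix (Fin n) (Fin n) ℂ) :
    (Fin n × Fin n) ⊕ (Fin n × Fin n) → ℝ :=
  Sum.elim (fun p => (A p.1 p.2).re) (fun p => (A p.1 p.2).im)

/-- The real dimension of a (real semialgebraic) set of complex `n × n` matrices. -/
noncomputable def realDim {n : ℕ} (S : Set (Matrix (Fin n) (Fin n) ℂ)) : WithBot ℕ∞ :=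
  semialgebraicDim (realCoords '' S)

/-! ### Krull dimension of integral extensions and of affine domains -/

/-! Put p = k', a = k - k', b = n - k - k', so n = 2p + a + b. Writing X = 2AAᴴ - 1 and Y = 2BBᴴ - 1
with isometries A, B, the spectrum of XY is governed by the singular values of AᴴB, the cosines of
the principal angles: p conjugate pairs on the unit circle, then -1 with multiplicity a and 1 with
multiplicity b (`exists_unitary_eq_of_mul`). Conversely every unitary matrix with such a spectrum is
a product (`conj_diagonal_mem_grassmannianProduct`). So the set is the union of the orbits U D(s) Uᴴ
with s in ℝᵖ. The centralizer of a generic D(s) in U(n) has dimension 2p + a² + b², which suggests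
the dimension p + n² - (2p + a² + b²), the asserted number.

To make this a Krull dimension, `productParam` sends (H, s) to cayley(H) D(s) cayley(-H), where H is
skew-Hermitian and vanishes on the diagonal blocks of the centralizer. It is rational without real
poles, so the polynomial functions on its image embed in a localized polynomial ring.
`semialgebraicDim_eq_card` then needs two facts. Zariski density (`eval_eq_zero_of_productParam`):
near 1 every unitary matrix is a Cayley transform off the blocks times one inside the blocks, and
the latter commutes with D(s); the identity theorem for regular functions extends vanishing from
there to the whole orbit. Independence: the derivative is injective at one point
(`exists_hasStrictFDerivAt_productParam`), so suitable linear forms map the image onto a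
neighbourhood and are algebraically independent. -/

theorem ringKrullDim_eq_of_injective_of_isIntegral (A B : Type*) [CommRing A] [CommRing B]
    [Algebra A B] [Algebra.IsIntegral A B] (hinj : Function.Injective (algebraMap A B)) :
    ringKrullDim B = ringKrullDim A := by
  apply le_antisymm
  -- Incomparability gives this inequality; lying over and going up give the other.
  · refine Order.krullDim_le_of_strictMono (PrimeSpectrum.comap (algebraMap A B)) ?_
    intro P Q hPQ
    exact Ideal.IsIntegral.comap_lt_comap (I := P.asIdeal) (J := Q.asIdeal) hPQ
  · refine iSup_le fun l => ?_
    have hker : RingHom.ker (algebraMap A B) ≤ l.head.asIdeal := by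
      rw [(RingHom.injective_iff_ker_eq_bot _).mp hinj]; exact bot_le
    obtain ⟨P, -, hP, hPl⟩ := Ideal.exists_ideal_over_prime_of_isIntegral (S := B)
      l.head.asIdeal ⊥ (by simpa [RingHom.ker] using hker)
    have : P.LiesOver (RelSeries.head l).asIdeal := ⟨hPl.symm⟩
    obtain ⟨L, hL, -, -⟩ := Ideal.exists_ltSeries_of_hasGoingUp l P
    rw [← hL]
    exact le_iSup (fun p : LTSeries (PrimeSpectrum B) => (p.length : WithBot ℕ∞)) L

/-- Noether normalization: A is integral over a polynomial ring in s variables, and both invariants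
equal s. -/
theorem ringKrullDim_eq_of_trdeg_eq {k A : Type} [Field k] [CommRing A] [IsDomain A]
    [Algebra k A] [Algebra.FiniteType k A] {m : ℕ} (h : Algebra.trdeg k A = m) :
    ringKrullDim A = m := by
  obtain ⟨s, g, hinj, hint⟩ := exists_integral_inj_algHom_of_fg k A
  algebraize [g.toRingHom]
  have halg : Algebra.IsIntegral (MvPolynomial (Fin s) k) A := ⟨hint⟩
  have hfaith : FaithfulSMul (MvPolynomial (Fin s) k) A :=
    (faithfulSMul_iff_algebraMap_injective _ _).2 hinj
  rw [ringKrullDim_eq_of_injective_of_isIntegral (MvPolynomial (Fin s) k) A hinj,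
    MvPolynomial.ringKrullDim_of_isNoetherianRing, ringKrullDim_eq_zero_of_field]
  have hst : IsScalarTower k (MvPolynomial (Fin s) k) A :=
    IsScalarTower.of_algebraMap_eq fun x => (g.commutes x).symm
  have h2 := trdeg_add_eq k (MvPolynomial (Fin s) k) (A := A)
  rw [trdeg_eq_zero (R := MvPolynomial (Fin s) k), h, MvPolynomial.trdeg_of_isDomain] at h2
  have : s = m := by simpa using h2
  simp [this]

/-! ### Rational functions on a real coordinate space without poles -/

/-- A function on `ℝ^τ` that is a quotient of polynomials, the denominator having no real zero. -/
def IsRegularFun {τ : Type*} (f : (τ → ℝ) → ℝ) : Prop :=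
  ∃ p q : MvPolynomial τ ℝ, ∀ t, MvPolynomial.eval t q ≠ 0 ∧
    f t * MvPolynomial.eval t q = MvPolynomial.eval t p

namespace IsRegularFun

variable {τ : Type*} {f g : (τ → ℝ) → ℝ}

theorem const (c : ℝ) : IsRegularFun (fun _ : τ → ℝ => c) :=
  ⟨MvPolynomial.C c, 1, fun t => by simp⟩

theorem coord (i : τ) : IsRegularFun (fun t : τ → ℝ => t i) :=
  ⟨MvPolynomial.X i, 1, fun t => by simp⟩

theorem add (hf : IsRegularFun f) (hg : IsRegularFun g) :
    IsRegularFun (fun t => f t + g t) := by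
  obtain ⟨p, q, h⟩ := hf
  obtain ⟨p', q', h'⟩ := hg
  refine ⟨p * q' + p' * q, q * q', fun t => ⟨?_, ?_⟩⟩
  · simpa using ⟨(h t).1, (h' t).1⟩
  · simp only [map_mul, map_add, ← (h t).2, ← (h' t).2]; ring

theorem mul (hf : IsRegularFun f) (hg : IsRegularFun g) :
    IsRegularFun (fun t => f t * g t) := by
  obtain ⟨p, q, h⟩ := hf
  obtain ⟨p', q', h'⟩ := hg
  refine ⟨p * p', q * q', fun t => ⟨?_, ?_⟩⟩
  · simpa using ⟨(h t).1, (h' t).1⟩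
  · simp only [map_mul, ← (h t).2, ← (h' t).2]; ring

theorem neg (hf : IsRegularFun f) : IsRegularFun (fun t => -f t) := by
  simpa using (const (-1)).mul hf

theorem sub (hf : IsRegularFun f) (hg : IsRegularFun g) :
    IsRegularFun (fun t => f t - g t) := by
  simpa [sub_eq_add_neg] using hf.add hg.neg

theorem inv (hf : IsRegularFun f) (h0 : ∀ t, f t ≠ 0) : IsRegularFun (fun t => (f t)⁻¹) := by
  obtain ⟨p, q, h⟩ := hf
  refine ⟨q, p, fun t => ⟨?_, ?_⟩⟩
  · rw [← (h t).2]; exact mul_ne_zero (h0 t) (h t).1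
  · rw [← (h t).2, ← mul_assoc, inv_mul_cancel₀ (h0 t), one_mul]

theorem eval {σ : Type*} {ψ : (τ → ℝ) → σ → ℝ} (hψ : ∀ i, IsRegularFun fun t => ψ t i)
    (P : MvPolynomial σ ℝ) : IsRegularFun (fun t => MvPolynomial.eval (ψ t) P) := by
  induction P using MvPolynomial.induction_on with
  | C a => simpa using const a
  | add p q hp hq => simpa using hp.add hq
  | mul_X p i hp => simpa using hp.mul (hψ i)

end IsRegularFun

/-- A ball of the sup metric is a product of infinite sets. -/
theorem MvPolynomial.eq_zero_of_eventually {τ : Type*} [Finite τ] {P : MvPolynomial τ ℝ}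
    {x : τ → ℝ} (h : ∀ᶠ t in nhds x, MvPolynomial.eval t P = 0) : P = 0 := by
  have := Fintype.ofFinite τ
  obtain ⟨ε, hε, hball⟩ := Metric.eventually_nhds_iff_ball.1 h
  refine MvPolynomial.funext_set (fun i => Metric.ball (x i) ε)
    (fun i => infinite_of_mem_nhds (x i) (Metric.ball_mem_nhds _ hε)) fun t ht => ?_
  rw [map_zero]
  exact hball t (by rw [ball_pi x hε]; exact ht)

theorem IsRegularFun.eq_zero_of_eventually {τ : Type*} [Finite τ] {f : (τ → ℝ) → ℝ}
    (hf : IsRegularFun f) {x : τ → ℝ} (h : ∀ᶠ t in nhds x, f t = 0) (t : τ → ℝ) : f t = 0 := by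
  obtain ⟨p, q, hpq⟩ := hf
  have hp : p = 0 := MvPolynomial.eq_zero_of_eventually (x := x) <| by
    filter_upwards [h] with t ht
    rw [← (hpq t).2, ht, zero_mul]
  have := (hpq t).2
  rw [hp, map_zero] at this
  exact (mul_eq_zero.mp this).resolve_right (hpq t).1

/-- The dimension of the closure of the image of a rational parametrization by `τ` variables
is the number of the variables, if there are as many independent polynomial functions on it. -/
theorem semialgebraicDim_eq_card {σ τ : Type} [Finite σ] [Finite τ] {S : Set (σ → ℝ)}
    {ψ : (τ → ℝ) → σ → ℝ} (hψ : ∀ i, IsRegularFun fun t => ψ t i) (hmem : ∀ t, ψ t ∈ S)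
    (hdense : ∀ p : MvPolynomial σ ℝ, (∀ t, MvPolynomial.eval (ψ t) p = 0) →
      ∀ x ∈ S, MvPolynomial.eval x p = 0)
    (y : τ → MvPolynomial σ ℝ)
    (hy : ∀ Q : MvPolynomial τ ℝ,
      (∀ t, MvPolynomial.eval (fun j => MvPolynomial.eval (ψ t) (y j)) Q = 0) → Q = 0) :
    semialgebraicDim S = Nat.card τ := by
  -- M consists of the polynomials without real zeros. Its localization is a domain of regular
  -- functions, on which evaluation at every real point still makes sense.
  let M : Submonoid (MvPolynomial τ ℝ) :=
    ⨅ t : τ → ℝ, (nonZeroDivisors ℝ).comap (MvPolynomial.eval t)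
  have hM : ∀ q, q ∈ M ↔ ∀ t, MvPolynomial.eval t q ≠ 0 := fun q => by
    simp [M, Submonoid.mem_iInf]
  have hM0 : M ≤ nonZeroDivisors (MvPolynomial τ ℝ) := by
    intro q hq
    rw [mem_nonZeroDivisors_iff_ne_zero]
    rintro rfl
    exact (hM 0).1 hq 0 (map_zero _)
  let L := Localization M
  have hdom : IsDomain L := IsLocalization.isDomain_localization hM0
  have hu : ∀ (t : τ → ℝ) (q : M), IsUnit (MvPolynomial.eval t q) := fun t q =>
    isUnit_iff_ne_zero.2 ((hM q).1 q.2 t)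
  let ev (t : τ → ℝ) : L →+* ℝ := IsLocalization.lift (M := M) (hu t)
  have hev : ∀ t p, ev t (algebraMap _ L p) = MvPolynomial.eval t p := fun t p =>
    IsLocalization.lift_eq _ p
  have hzero : ∀ a : L, (∀ t, ev t a = 0) → a = 0 := by
    intro a ha
    obtain ⟨⟨p, q⟩, hpq⟩ := IsLocalization.surj M a
    have hp : p = 0 := MvPolynomial.funext fun t => by
      rw [← hev, ← hpq, map_mul, ha, zero_mul, map_zero]
    rw [hp, map_zero] at hpq
    exact (IsLocalization.map_units L q).mul_left_eq_zero.1 hpq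
  choose p q hpq using hψ
  have hqM : ∀ i, q i ∈ M := fun i => (hM _).2 fun t => (hpq i t).1
  let v : σ → L := fun i => IsLocalization.mk' L (p i) ⟨q i, hqM i⟩
  have hv : ∀ t i, ev t (v i) = ψ t i := by
    intro t i
    have h1 : v i * algebraMap _ L (q i) = algebraMap _ L (p i) :=
      IsLocalization.mk'_spec L (p i) ⟨q i, hqM i⟩
    have h2 := congrArg (ev t) h1
    rw [map_mul, hev, hev, ← (hpq i t).2] at h2
    exact mul_right_cancel₀ (hpq i t).1 h2
  let φ : MvPolynomial σ ℝ →ₐ[ℝ] L := MvPolynomial.aeval v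
  have hφ : ∀ t P, ev t (φ P) = MvPolynomial.eval (ψ t) P := by
    intro t P
    induction P using MvPolynomial.induction_on with
    | C a =>
      have : φ (MvPolynomial.C a) = algebraMap (MvPolynomial τ ℝ) L (MvPolynomial.C a) := by
        simp only [φ, MvPolynomial.aeval_C]
        rfl
      rw [this, hev]; simp
    | add p q hp hq => simp [hp, hq]
    | mul_X p i hp => simp [hp, φ, hv]
  -- φ is pullback along ψ; by density, vanishing on S is the same as vanishing on the image of ψ.
  have hI : MvPolynomial.vanishingIdeal ℝ S = RingHom.ker φ := by
    ext P
    rw [MvPolynomial.mem_vanishingIdeal_iff, RingHom.mem_ker]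
    constructor
    · intro h
      refine hzero _ fun t => ?_
      rw [hφ]
      simpa [MvPolynomial.aeval_eq_eval] using h _ (hmem t)
    · intro h x hx
      rw [MvPolynomial.aeval_eq_eval]
      refine hdense P (fun t => ?_) x hx
      rw [← hφ, h, map_zero]
  rw [semialgebraicDim, hI]
  have hprime : (RingHom.ker φ).IsPrime := RingHom.ker_isPrime φ
  refine ringKrullDim_eq_of_trdeg_eq (k := ℝ) ?_
  apply le_antisymm
  -- Upper bound: the quotient embeds in L, which is algebraic over the polynomial ring in τ.
  · refine (trdeg_le_of_injective (Ideal.kerLiftAlg φ) (Ideal.kerLiftAlg_injective φ)).trans ?_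
    have : Algebra.IsAlgebraic (MvPolynomial τ ℝ) L := IsLocalization.isAlgebraic _ M
    have : FaithfulSMul (MvPolynomial τ ℝ) L :=
      (faithfulSMul_iff_algebraMap_injective _ _).2 (IsLocalization.injective L hM0)
    have h2 := trdeg_add_eq ℝ (MvPolynomial τ ℝ) (A := L)
    rw [trdeg_eq_zero (R := MvPolynomial τ ℝ), MvPolynomial.trdeg_of_isDomain, add_zero] at h2
    rw [← h2]
    simp [Nat.cast_card]
  · have hind : AlgebraicIndependent ℝ (fun j => Ideal.Quotient.mk (RingHom.ker φ) (y j)) := by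
      rw [algebraicIndependent_iff]
      intro Q hQ
      refine hy Q fun t => ?_
      have h2 : φ (MvPolynomial.aeval y Q) = 0 := by
        rw [← RingHom.mem_ker, ← Ideal.Quotient.eq_zero_iff_mem, ← hQ,
          MvPolynomial.aeval_def, MvPolynomial.aeval_def, MvPolynomial.hom_eval₂]
        rfl
      have h3 := congrArg (ev t) h2
      rw [hφ, map_zero] at h3
      rw [← h3, MvPolynomial.aeval_def, MvPolynomial.hom_eval₂]
      have hc : (MvPolynomial.eval (ψ t)).comp MvPolynomial.C = RingHom.id ℝ := by ext; simp
      rw [MvPolynomial.algebraMap_eq, hc]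
      rfl
    have := hind.cardinalMk_le_trdeg
    simpa [Nat.cast_card] using this

/-! ### Regular complex functions and regular matrix functions -/

/-- A complex valued function on `ℝ^τ` with regular real and imaginary parts. -/
def IsRegularComplexFun {τ : Type*} (f : (τ → ℝ) → ℂ) : Prop :=
  IsRegularFun (fun t => (f t).re) ∧ IsRegularFun (fun t => (f t).im)

namespace IsRegularComplexFun

variable {τ : Type*} {f g : (τ → ℝ) → ℂ}

theorem const (c : ℂ) : IsRegularComplexFun (fun _ : τ → ℝ => c) :=
  ⟨IsRegularFun.const _, IsRegularFun.const _⟩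

theorem ofReal {f : (τ → ℝ) → ℝ} (hf : IsRegularFun f) :
    IsRegularComplexFun (fun t => (f t : ℂ)) :=
  ⟨by simpa using hf, by simpa using IsRegularFun.const 0⟩

theorem add (hf : IsRegularComplexFun f) (hg : IsRegularComplexFun g) :
    IsRegularComplexFun (fun t => f t + g t) :=
  ⟨by simpa using hf.1.add hg.1, by simpa using hf.2.add hg.2⟩

theorem mul (hf : IsRegularComplexFun f) (hg : IsRegularComplexFun g) :
    IsRegularComplexFun (fun t => f t * g t) :=
  ⟨by simpa using (hf.1.mul hg.1).sub (hf.2.mul hg.2),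
    by simpa using (hf.1.mul hg.2).add (hf.2.mul hg.1)⟩

theorem neg (hf : IsRegularComplexFun f) : IsRegularComplexFun (fun t => -f t) :=
  ⟨by simpa using hf.1.neg, by simpa using hf.2.neg⟩

theorem sub (hf : IsRegularComplexFun f) (hg : IsRegularComplexFun g) :
    IsRegularComplexFun (fun t => f t - g t) := by
  simpa [sub_eq_add_neg] using hf.add hg.neg

theorem inv (hf : IsRegularComplexFun f) (h0 : ∀ t, f t ≠ 0) :
    IsRegularComplexFun (fun t => (f t)⁻¹) := by
  have h : IsRegularFun (fun t => (Complex.normSq (f t))⁻¹) :=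
    (by simpa [Complex.normSq_apply] using (hf.1.mul hf.1).add (hf.2.mul hf.2) :
      IsRegularFun (fun t => Complex.normSq (f t))).inv
      fun t => (Complex.normSq_pos.2 (h0 t)).ne'
  exact ⟨by simpa [div_eq_mul_inv] using hf.1.mul h,
    by simpa [div_eq_mul_inv] using hf.2.neg.mul h⟩

theorem sum {ι : Type*} {s : Finset ι} {f : ι → (τ → ℝ) → ℂ}
    (hf : ∀ i, IsRegularComplexFun (f i)) :
    IsRegularComplexFun (fun t => ∑ i ∈ s, f i t) := by
  classical
  induction s using Finset.induction_on with
  | empty => simpa using const 0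
  | insert a s ha ih => simpa [Finset.sum_insert ha] using (hf a).add ih

theorem prod {ι : Type*} {s : Finset ι} {f : ι → (τ → ℝ) → ℂ}
    (hf : ∀ i, IsRegularComplexFun (f i)) :
    IsRegularComplexFun (fun t => ∏ i ∈ s, f i t) := by
  classical
  induction s using Finset.induction_on with
  | empty => simpa using const 1
  | insert a s ha ih => simpa [Finset.prod_insert ha] using (hf a).mul ih

end IsRegularComplexFun

/-- A matrix valued function on `ℝ^τ` with regular entries. -/
def IsRegularMatrixFun {τ m : Type*} (A : (τ → ℝ) → Matrix m m ℂ) : Prop :=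
  ∀ i j, IsRegularComplexFun (fun t => A t i j)

namespace IsRegularMatrixFun

variable {τ m : Type*} {A B : (τ → ℝ) → Matrix m m ℂ}

theorem const (C : Matrix m m ℂ) : IsRegularMatrixFun (fun _ : τ → ℝ => C) :=
  fun i j => .const (C i j)

theorem add (hA : IsRegularMatrixFun A) (hB : IsRegularMatrixFun B) :
    IsRegularMatrixFun (fun t => A t + B t) := fun i j => (hA i j).add (hB i j)

theorem sub (hA : IsRegularMatrixFun A) (hB : IsRegularMatrixFun B) :
    IsRegularMatrixFun (fun t => A t - B t) := fun i j => (hA i j).sub (hB i j)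

theorem neg (hA : IsRegularMatrixFun A) : IsRegularMatrixFun (fun t => -A t) :=
  fun i j => (hA i j).neg

theorem mul [Fintype m] (hA : IsRegularMatrixFun A) (hB : IsRegularMatrixFun B) :
    IsRegularMatrixFun (fun t => A t * B t) := fun i j => by
  simpa [Matrix.mul_apply] using IsRegularComplexFun.sum fun k => (hA i k).mul (hB k j)

variable [DecidableEq m]

theorem diagonal {d : (τ → ℝ) → m → ℂ} (hd : ∀ i, IsRegularComplexFun fun t => d t i) :
    IsRegularMatrixFun (fun t => Matrix.diagonal (d t)) := fun i j => by
  by_cases h : i = j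
  · subst h; simpa using hd i
  · simpa [Matrix.diagonal_apply_ne _ h] using IsRegularComplexFun.const 0

variable [Fintype m]

theorem det (hA : IsRegularMatrixFun A) : IsRegularComplexFun (fun t => (A t).det) := by
  simp only [Matrix.det_apply']
  exact IsRegularComplexFun.sum fun σ => (IsRegularComplexFun.const _).mul
    (IsRegularComplexFun.prod fun i => hA _ _)

theorem inv (hA : IsRegularMatrixFun A) (h0 : ∀ t, (A t).det ≠ 0) :
    IsRegularMatrixFun (fun t => (A t)⁻¹) := fun i j => by
  simp only [Matrix.inv_def, Ring.inverse_eq_inv', Matrix.smul_apply, smul_eq_mul,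
    Matrix.adjugate_apply]
  refine (hA.det.inv h0).mul (IsRegularMatrixFun.det fun a b => ?_)
  by_cases h : a = j
  · subst h; simpa using IsRegularComplexFun.const ((Pi.single i 1 : m → ℂ) b)
  · simpa [Matrix.updateRow_ne h] using hA a b

end IsRegularMatrixFun

/-! ### The Cayley transform -/

/-- The Cayley transform of a complex matrix. -/
noncomputable def cayley {m : Type*} [Fintype m] [DecidableEq m] (H : Matrix m m ℂ) :
    Matrix m m ℂ :=
  (1 - H) * (1 + H)⁻¹

section Cayley

variable {m : Type*} [Fintype m] [DecidableEq m] {H U : Matrix m m ℂ}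

-- (1 + H)ᴴ(1 + H) = 1 + HᴴH is positive definite. Hence the Cayley transform has no poles on
-- skew-Hermitian matrices.
open scoped ComplexOrder in
theorem isUnit_det_one_add_of_skew (hH : Hᴴ = -H) : IsUnit (1 + H).det := by
  have h1 : (1 + H)ᴴ * (1 + H) = 1 + Hᴴ * H := by
    simp only [Matrix.conjTranspose_add, Matrix.conjTranspose_one, hH]; noncomm_ring
  have h2 : (1 + Hᴴ * H).PosDef :=
    Matrix.PosDef.one.add_posSemidef (Matrix.posSemidef_conjTranspose_mul_self H)
  have h3 : IsUnit ((1 + H)ᴴ * (1 + H)).det := by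
    rw [h1]; exact isUnit_iff_ne_zero.2 h2.det_pos.ne'
  rw [Matrix.det_mul] at h3
  exact isUnit_of_mul_isUnit_right h3

theorem cayley_mul_cayley_neg (hH : Hᴴ = -H) : cayley H * cayley (-H) = 1 := by
  have h1 := isUnit_det_one_add_of_skew hH
  have h2 : IsUnit (1 + -H).det :=
    isUnit_det_one_add_of_skew (by rw [Matrix.conjTranspose_neg, hH])
  rw [cayley, cayley, sub_neg_eq_add, Matrix.mul_assoc, ← Matrix.mul_assoc _ (1 + H),
    Matrix.nonsing_inv_mul _ h1, Matrix.one_mul, sub_eq_add_neg, Matrix.mul_nonsing_inv _ h2]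

theorem conjTranspose_cayley (hH : Hᴴ = -H) : (cayley H)ᴴ = cayley (-H) := by
  have h2 : IsUnit (1 + -H).det :=
    isUnit_det_one_add_of_skew (by rw [Matrix.conjTranspose_neg, hH])
  rw [cayley, cayley, Matrix.conjTranspose_mul, Matrix.conjTranspose_nonsing_inv,
    Matrix.conjTranspose_add, Matrix.conjTranspose_sub, Matrix.conjTranspose_one, hH]
  have h3 : (1 - -H) * (1 + -H) = (1 + -H) * (1 - -H) := by noncomm_ring
  calc (1 + -H)⁻¹ * (1 - -H) = (1 + -H)⁻¹ * ((1 - -H) * (1 + -H)) * (1 + -H)⁻¹ := by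
        rw [Matrix.mul_assoc, Matrix.mul_assoc, Matrix.mul_nonsing_inv _ h2, Matrix.mul_one]
    _ = _ := by rw [h3, ← Matrix.mul_assoc, Matrix.nonsing_inv_mul _ h2, Matrix.one_mul]

theorem cayley_mem_unitaryGroup (hH : Hᴴ = -H) : cayley H ∈ Matrix.unitaryGroup m ℂ := by
  rw [Matrix.mem_unitaryGroup_iff, Matrix.star_eq_conjTranspose, conjTranspose_cayley hH,
    cayley_mul_cayley_neg hH]

theorem conjTranspose_cayley_of_mem_unitaryGroup (hU : U ∈ Matrix.unitaryGroup m ℂ)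
    (h1 : IsUnit (1 + U).det) : (cayley U)ᴴ = -cayley U := by
  have hUU : Uᴴ * U = 1 := Matrix.mem_unitaryGroup_iff'.1 hU
  have h2 : IsUnit (1 + Uᴴ).det := by
    have : 1 + Uᴴ = (1 + U)ᴴ := by simp
    rw [this, Matrix.det_conjTranspose]; exact h1.star
  rw [cayley, Matrix.conjTranspose_mul, Matrix.conjTranspose_nonsing_inv,
    Matrix.conjTranspose_add, Matrix.conjTranspose_sub, Matrix.conjTranspose_one]
  have h3 : (1 - Uᴴ) * (1 + U) = -((1 + Uᴴ) * (1 - U)) := by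
    have e1 : (1 - Uᴴ) * (1 + U) = 1 + U - Uᴴ - Uᴴ * U := by noncomm_ring
    have e2 : (1 + Uᴴ) * (1 - U) = 1 - U + Uᴴ - Uᴴ * U := by noncomm_ring
    rw [e1, e2, hUU]; abel
  calc (1 + Uᴴ)⁻¹ * (1 - Uᴴ) = (1 + Uᴴ)⁻¹ * ((1 - Uᴴ) * (1 + U)) * (1 + U)⁻¹ := by
        rw [Matrix.mul_assoc, Matrix.mul_assoc, Matrix.mul_nonsing_inv _ h1, Matrix.mul_one]
    _ = _ := by
      rw [h3, Matrix.mul_neg, ← Matrix.mul_assoc, Matrix.nonsing_inv_mul _ h2, Matrix.one_mul,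
        Matrix.neg_mul]

theorem cayley_cayley (h1 : IsUnit (1 + U).det) : cayley (cayley U) = U := by
  have e1 : 1 - cayley U = (2 : ℂ) • (U * (1 + U)⁻¹) := by
    nth_rw 1 [← Matrix.mul_nonsing_inv _ h1]
    rw [cayley, ← Matrix.sub_mul, ← Matrix.smul_mul]
    congr 1; rw [two_smul]; abel
  have e2 : 1 + cayley U = (2 : ℂ) • (1 + U)⁻¹ := by
    nth_rw 1 [← Matrix.mul_nonsing_inv _ h1]
    rw [cayley, ← Matrix.add_mul]
    have : (1 + U) + (1 - U) = (2 : ℂ) • (1 : Matrix m m ℂ) := by rw [two_smul]; abel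
    rw [this, Matrix.smul_mul, Matrix.one_mul]
  have e3 : (1 + cayley U)⁻¹ = (2 : ℂ)⁻¹ • (1 + U) := by
    apply Matrix.inv_eq_right_inv
    rw [e2, Matrix.smul_mul, Matrix.mul_smul, smul_smul, Matrix.nonsing_inv_mul _ h1]
    norm_num
  rw [cayley, e1, e3, Matrix.smul_mul, Matrix.mul_smul, smul_smul, Matrix.mul_assoc,
    Matrix.nonsing_inv_mul _ h1]
  norm_num

end Cayley

theorem IsRegularMatrixFun.cayley {τ m : Type*} [Fintype m] [DecidableEq m]
    {A : (τ → ℝ) → Matrix m m ℂ} (hA : IsRegularMatrixFun A) (hs : ∀ t, (A t)ᴴ = -A t) :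
    IsRegularMatrixFun (fun t => cayley (A t)) :=
  ((IsRegularMatrixFun.const 1).sub hA).mul (((IsRegularMatrixFun.const 1).add hA).inv
    fun t => (isUnit_det_one_add_of_skew (hs t)).ne_zero)

/-! ### Real coordinates on skew-Hermitian matrices -/

/-- Real square matrices as coordinates on the skew-Hermitian matrices. -/
noncomputable def skewOfReal {m : Type*} : (m × m → ℝ) →ₗ[ℝ] Matrix m m ℂ where
  -- The antisymmetric part of R gives the real part and the symmetric part the imaginary part. No
  -- order on the indices is chosen, and support in a symmetric set of positions is preserved.
  toFun R := Matrix.of fun i j => ⟨R (i, j) - R (j, i), R (i, j) + R (j, i)⟩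
  map_add' R S := by ext i j; apply Complex.ext <;> simp <;> ring
  map_smul' c R := by ext i j; apply Complex.ext <;> simp <;> ring

/-- The linear left inverse of `skewOfReal`. -/
noncomputable def realOfSkew {m : Type*} : Matrix m m ℂ →ₗ[ℝ] (m × m → ℝ) where
  toFun A p := ((A p.1 p.2).re + (A p.1 p.2).im) / 2
  map_add' A B := by ext p; simp; ring
  map_smul' c A := by ext p; simp; ring

section Skew

variable {m : Type*}

theorem skewOfReal_apply (R : m × m → ℝ) (i j : m) :
    skewOfReal R i j = ⟨R (i, j) - R (j, i), R (i, j) + R (j, i)⟩ := rfl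

theorem conjTranspose_skewOfReal (R : m × m → ℝ) : (skewOfReal R)ᴴ = -skewOfReal R := by
  ext i j; apply Complex.ext <;> simp [skewOfReal_apply]; ring

theorem realOfSkew_skewOfReal (R : m × m → ℝ) : realOfSkew (skewOfReal R) = R := by
  ext ⟨i, j⟩; simp [realOfSkew, skewOfReal_apply]

theorem skewOfReal_realOfSkew {A : Matrix m m ℂ} (hA : Aᴴ = -A) :
    skewOfReal (realOfSkew A) = A := by
  ext i j
  have h := congrFun (congrFun hA i) j
  have h1 := congrArg Complex.re h
  have h2 := congrArg Complex.im h
  simp only [Matrix.conjTranspose_apply, Complex.star_def, Complex.conj_re, Complex.conj_im,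
    Matrix.neg_apply, Complex.neg_re, Complex.neg_im] at h1 h2
  apply Complex.ext <;> simp [realOfSkew, skewOfReal_apply] <;> linarith

theorem isRegularMatrixFun_skewOfReal {τ : Type*} {R : (τ → ℝ) → m × m → ℝ}
    (hR : ∀ p, IsRegularFun fun t => R t p) : IsRegularMatrixFun (fun t => skewOfReal (R t)) :=
  fun i j => ⟨(hR (i, j)).sub (hR (j, i)), (hR (i, j)).add (hR (j, i))⟩

end Skew

/-! ### A rational parametrization of the unit circle -/

/-- A rational parametrization of the whole unit circle by the real line. -/
noncomputable def circleParam (s : ℝ) : ℂ := ((1 + s * Complex.I) / (1 - s * Complex.I)) ^ 2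

section CircleParam

theorem one_sub_mul_I_ne_zero (s : ℝ) : (1 : ℂ) - s * Complex.I ≠ 0 := fun h => by
  simpa using congrArg Complex.re h

theorem one_add_mul_I_ne_zero (s : ℝ) : (1 : ℂ) + s * Complex.I ≠ 0 := fun h => by
  simpa using congrArg Complex.re h

theorem star_circleParam (s : ℝ) : star (circleParam s) = circleParam (-s) := by
  simp [circleParam, sub_eq_add_neg]

theorem circleParam_mul_star (s : ℝ) : circleParam s * star (circleParam s) = 1 := by
  have h1 := one_sub_mul_I_ne_zero s
  have h2 := one_add_mul_I_ne_zero s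
  rw [star_circleParam, circleParam, circleParam, ← mul_pow]
  push_cast
  rw [neg_mul, sub_neg_eq_add, ← sub_eq_add_neg]
  field_simp

theorem circleParam_zero : circleParam 0 = 1 := by simp [circleParam]

theorem circleParam_one : circleParam 1 = -1 := by
  have h1 := one_sub_mul_I_ne_zero 1
  rw [circleParam, div_pow, div_eq_iff (pow_ne_zero 2 h1)]
  push_cast
  linear_combination 2 * Complex.I_sq

/-- Stereographic projection reaches every square root w of z except w = -1; then z = 1, the value
at s = 0. -/
theorem exists_circleParam_eq {z : ℂ} (hz : ‖z‖ = 1) : ∃ s, circleParam s = z := by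
  obtain ⟨w, rfl⟩ := IsAlgClosed.exists_pow_nat_eq z (n := 2) two_pos
  have hw : w.re * w.re + w.im * w.im = 1 := by
    have h1 : ‖w‖ = 1 := by
      rw [norm_pow] at hz
      exact (pow_eq_one_iff_of_nonneg (norm_nonneg w) two_ne_zero).1 hz
    rw [← Complex.normSq_apply, Complex.normSq_eq_norm_sq, h1, one_pow]
  by_cases h : 1 + w.re = 0
  · have h2 : w.im = 0 := by nlinarith
    refine ⟨0, ?_⟩
    have : w = -1 := by apply Complex.ext <;> simp [h2]; linarith
    rw [circleParam_zero, this]; norm_num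
  · obtain ⟨s, hs⟩ : ∃ s : ℝ, s * (1 + w.re) = w.im := ⟨_, div_mul_cancel₀ _ h⟩
    refine ⟨s, ?_⟩
    rw [circleParam]
    congr 1
    rw [div_eq_iff (one_sub_mul_I_ne_zero _)]
    apply Complex.ext
    · have : (1 - w.re - w.im * s) * (1 + w.re) = 0 := by linear_combination -w.im * hs - hw
      have := (mul_eq_zero.1 this).resolve_right h
      simp; linarith
    · simp; linarith

/-- Equal squares come from equal quotients, so s = t, or from opposite ones, so st = -1, which the
interval excludes. -/
theorem circleParam_injOn : Set.InjOn circleParam (Set.Ioc (-1) 1) := by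
  intro s hs t ht h
  have a1 := one_sub_mul_I_ne_zero s
  have a2 := one_sub_mul_I_ne_zero t
  rcases sq_eq_sq_iff_eq_or_eq_neg.1 h with h | h
  · rw [div_eq_div_iff a1 a2] at h
    have := congrArg Complex.im h
    simp at this
    linarith
  · rw [← neg_div, div_eq_div_iff a1 a2] at h
    have := congrArg Complex.re h
    simp at this
    nlinarith [hs.1, hs.2, ht.1, ht.2]

theorem isRegularComplexFun_circleParam {τ : Type*} {f : (τ → ℝ) → ℝ} (hf : IsRegularFun f) :
    IsRegularComplexFun (fun t => circleParam (f t)) := by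
  have hI : IsRegularComplexFun (fun t => (f t : ℂ) * Complex.I) :=
    (IsRegularComplexFun.ofReal hf).mul (.const _)
  have h := ((IsRegularComplexFun.const 1).add hI).mul
    (((IsRegularComplexFun.const 1).sub hI).inv fun t => one_sub_mul_I_ne_zero (f t))
  simpa [circleParam, sq, div_eq_mul_inv] using h.mul h

theorem exists_hasStrictDerivAt_circleParam (s : ℝ) :
    ∃ c : ℂ, c ≠ 0 ∧ HasStrictDerivAt circleParam c s := by
  have a1 := one_sub_mul_I_ne_zero s
  have a2 := one_add_mul_I_ne_zero s
  have h0 : HasStrictDerivAt (fun s : ℝ => (s : ℂ) * Complex.I) Complex.I s := by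
    simpa using (Complex.ofRealCLM.hasStrictDerivAt (x := s)).mul_const Complex.I
  have h1 := ((h0.const_add 1).div (h0.const_sub 1) a1).pow 2
  refine ⟨_, ?_, h1⟩
  have : Complex.I * (1 - s * Complex.I) - (1 + s * Complex.I) * -Complex.I
    = 2 * Complex.I := by ring
  rw [this]
  simp [a1, a2, div_eq_zero_iff]

end CircleParam

/-! ### Unitary diagonalization -/

section Diagonalization

variable {m : Type*} [Fintype m] [DecidableEq m]

theorem Matrix.IsHermitian.exists_unitary_diagonalization {A : Matrix m m ℂ}
    (hA : A.IsHermitian) :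
    ∃ V ∈ Matrix.unitaryGroup m ℂ, ∃ μ : m → ℝ,
      A = V * Matrix.diagonal (fun i => (μ i : ℂ)) * Vᴴ := by
  refine ⟨_, hA.eigenvectorUnitary.2, hA.eigenvalues, ?_⟩
  conv_lhs => rw [hA.spectral_theorem]
  rfl

/-- A unitary matrix is a Cayley transform up to a phase. -/
theorem exists_smul_eq_cayley {U : Matrix m m ℂ} (hU : U ∈ Matrix.unitaryGroup m ℂ) :
    ∃ c : ℂ, c * star c = 1 ∧ ∃ H : Matrix m m ℂ, Hᴴ = -H ∧ c • U = cayley H := by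
  -- Choose a point z of the circle outside the finite spectrum; the phase c = -conj z moves z to
  -- -1, so -1 is not an eigenvalue of cU.
  obtain ⟨_, ⟨s, hs, rfl⟩, hroot⟩ :=
    ((Set.Ioc_infinite (by norm_num : (-1 : ℝ) < 1)).image circleParam_injOn).exists_notMem_finset
      U.charpoly.roots.toFinset
  rw [Multiset.mem_toFinset, Polynomial.mem_roots U.charpoly_monic.ne_zero, Polynomial.IsRoot,
    Matrix.eval_charpoly] at hroot
  have hc : -star (circleParam s) * star (-star (circleParam s)) = 1 := by
    rw [star_neg, star_star, neg_mul_neg, mul_comm, circleParam_mul_star]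
  refine ⟨-star (circleParam s), hc, ?_⟩
  set c := -star (circleParam s)
  have h1 : IsUnit (1 + c • U).det := by
    have hcz : c * circleParam s = -1 := by
      rw [neg_mul, mul_comm, circleParam_mul_star]
    have : 1 + c • U = (-c) • (Matrix.scalar m (circleParam s) - U) := by
      ext i j
      by_cases hij : i = j
      · subst hij
        simp only [Matrix.add_apply, Matrix.smul_apply, Matrix.sub_apply, Matrix.scalar_apply,
          Matrix.diagonal_apply_eq, Matrix.one_apply_eq, smul_eq_mul]
        linear_combination hcz
      · simp [hij]
    rw [this, Matrix.det_smul]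
    refine (IsUnit.pow _ ?_).mul (isUnit_iff_ne_zero.2 hroot)
    refine (isUnit_iff_ne_zero.2 ?_).neg
    rintro h0
    rw [h0, zero_mul] at hc
    exact zero_ne_one hc
  have hcU : c • U ∈ Matrix.unitaryGroup m ℂ := by
    rw [Matrix.mem_unitaryGroup_iff] at hU ⊢
    rw [star_smul, Matrix.smul_mul, Matrix.mul_smul, smul_smul, hU, hc, one_smul]
  exact ⟨cayley (c • U), conjTranspose_cayley_of_mem_unitaryGroup hcU h1, (cayley_cayley h1).symm⟩

theorem cayley_conj {V D : Matrix m m ℂ} (hV : V ∈ Matrix.unitaryGroup m ℂ) :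
    cayley (V * D * Vᴴ) = V * cayley D * Vᴴ := by
  have h1 : V * Vᴴ = 1 := Matrix.mem_unitaryGroup_iff.1 hV
  have h2 : Vᴴ * V = 1 := Matrix.mem_unitaryGroup_iff'.1 hV
  have e1 : 1 - V * D * Vᴴ = V * (1 - D) * Vᴴ := by
    rw [Matrix.mul_sub, Matrix.sub_mul, Matrix.mul_one, h1]
  have e2 : 1 + V * D * Vᴴ = V * (1 + D) * Vᴴ := by
    rw [Matrix.mul_add, Matrix.add_mul, Matrix.mul_one, h1]
  have e3 : V⁻¹ = Vᴴ := Matrix.inv_eq_right_inv h1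
  have e4 : (Vᴴ)⁻¹ = V := Matrix.inv_eq_right_inv h2
  rw [cayley, cayley, e1, e2, Matrix.mul_inv_rev, Matrix.mul_inv_rev, e3, e4]
  simp only [Matrix.mul_assoc]
  rw [← Matrix.mul_assoc Vᴴ V, h2, Matrix.one_mul]

/-- Reduces to the Hermitian spectral theorem: a phase multiple of U is cayley H with iH Hermitian,
and the Cayley transform respects conjugation and diagonal matrices. -/
theorem exists_unitary_diagonalization_of_mem_unitaryGroup {U : Matrix m m ℂ}
    (hU : U ∈ Matrix.unitaryGroup m ℂ) :
    ∃ V ∈ Matrix.unitaryGroup m ℂ, ∃ μ : m → ℂ, U = V * Matrix.diagonal μ * Vᴴ := by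
  obtain ⟨c, hc, H, hH, hcU⟩ := exists_smul_eq_cayley hU
  have hK : (Complex.I • H).IsHermitian := by
    rw [Matrix.IsHermitian, Matrix.conjTranspose_smul, hH]; simp
  obtain ⟨V, hV, h, hh⟩ := hK.exists_unitary_diagonalization
  have hH2 : H = V * Matrix.diagonal (fun i => -Complex.I * h i) * Vᴴ := by
    have : H = (-Complex.I) • (Complex.I • H) := by rw [smul_smul]; simp
    rw [this, hh, ← Matrix.smul_mul, ← Matrix.mul_smul, ← Matrix.diagonal_smul]
    rfl
  have hdiag : ∃ d : m → ℂ, cayley (Matrix.diagonal (fun i => -Complex.I * h i)) =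
      Matrix.diagonal d := by
    rw [cayley, ← Matrix.diagonal_one, Matrix.diagonal_add, Matrix.diagonal_sub,
      Matrix.inv_diagonal, Matrix.diagonal_mul_diagonal]
    exact ⟨_, rfl⟩
  obtain ⟨d, hd⟩ := hdiag
  refine ⟨V, hV, star c • d, ?_⟩
  have : U = star c • (c • U) := by rw [smul_smul, mul_comm, hc, one_smul]
  rw [this, hcU, hH2, cayley_conj hV, hd, ← Matrix.smul_mul, ← Matrix.mul_smul,
    ← Matrix.diagonal_smul]

-- Fibres of f and g over the same value have equal cardinality; glue bijections between them.
omit [DecidableEq m] in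
theorem exists_equiv_of_map_univ_eq {α : Type*} {f g : m → α}
    (h : Finset.univ.val.map f = Finset.univ.val.map g) : ∃ e : m ≃ m, f = g ∘ e := by
  classical
  have hcard : ∀ a, Nonempty ({i // f i = a} ≃ {i // g i = a}) := fun a => by
    rw [← Fintype.card_eq, Fintype.card_subtype, Fintype.card_subtype]
    have := congrArg (Multiset.count a) h
    rw [Multiset.count_map, Multiset.count_map] at this
    simpa [Finset.card_def, eq_comm] using this
  let F := fun a => (hcard a).some
  refine ⟨((Equiv.sigmaFiberEquiv f).symm.trans (Equiv.sigmaCongrRight F)).trans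
    (Equiv.sigmaFiberEquiv g), ?_⟩
  ext i
  exact (F (f i) ⟨i, rfl⟩).2.symm

end Diagonalization

/-! ### Involutions as reflections -/

theorem conjTranspose_submatrix_mul_submatrix {n p : Type*} [Fintype n] [DecidableEq n]
    {V : Matrix n n ℂ} (hV : V ∈ Matrix.unitaryGroup n ℂ) {f : p → n} (hf : f.Injective)
    [DecidableEq p] : (V.submatrix id f)ᴴ * V.submatrix id f = 1 := by
  have h2 : Vᴴ * V = 1 := Matrix.mem_unitaryGroup_iff'.1 hV
  rw [Matrix.conjTranspose_submatrix, ← Matrix.submatrix_mul _ _ _ _ _ Function.bijective_id, h2,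
    Matrix.submatrix_one _ hf]

/-- X is Hermitian with eigenvalues ±1, and the trace shows that +1 occurs k times; the columns of A
are the corresponding eigenvectors. -/
theorem exists_isometry_of_mem_complexGrassmannian {k n : ℕ} {X : Matrix (Fin n) (Fin n) ℂ}
    (hX : X ∈ complexGrassmannian k n) :
    ∃ A : Matrix (Fin n) (Fin k) ℂ, Aᴴ * A = 1 ∧ X = (2 : ℂ) • (A * Aᴴ) - 1 := by
  obtain ⟨hU, h2, htr⟩ := hX
  have hXX : Xᴴ * X = 1 := Matrix.mem_unitaryGroup_iff'.1 hU
  have hherm : X.IsHermitian := by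
    calc Xᴴ = Xᴴ * (X ^ 2) := by rw [h2, Matrix.mul_one]
      _ = X := by rw [sq, ← Matrix.mul_assoc, hXX, Matrix.one_mul]
  obtain ⟨V, hV, μ, hμ⟩ := hherm.exists_unitary_diagonalization
  have hV1 : V * Vᴴ = 1 := Matrix.mem_unitaryGroup_iff.1 hV
  have hV2 : Vᴴ * V = 1 := Matrix.mem_unitaryGroup_iff'.1 hV
  have hD : Matrix.diagonal (fun i => (μ i : ℂ)) = Vᴴ * X * V := by
    rw [hμ]
    simp only [Matrix.mul_assoc, hV2, Matrix.mul_one]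
    rw [← Matrix.mul_assoc, hV2, Matrix.one_mul]
  have hsq : ∀ i, μ i = 1 ∨ μ i = -1 := by
    intro i
    have h3 : Matrix.diagonal (fun i => (μ i : ℂ)) * Matrix.diagonal (fun i => (μ i : ℂ)) = 1 := by
      rw [hD]
      calc Vᴴ * X * V * (Vᴴ * X * V) = Vᴴ * X * (V * Vᴴ) * X * V := by
            simp only [Matrix.mul_assoc]
        _ = Vᴴ * (X ^ 2) * V := by rw [hV1, Matrix.mul_one, sq]; simp only [Matrix.mul_assoc]
        _ = 1 := by rw [h2, Matrix.mul_one, hV2]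
    rw [Matrix.diagonal_mul_diagonal] at h3
    have h4 := congrFun (congrFun h3 i) i
    rw [Matrix.diagonal_apply_eq, Matrix.one_apply_eq] at h4
    exact mul_self_eq_one_iff.1 (by exact_mod_cast h4)
  have htr2 : ∑ i, μ i = 2 * k - n := by
    have h5 : X.trace = ∑ i, (μ i : ℂ) := by
      rw [hμ, Matrix.trace_mul_cycle, hV2, Matrix.one_mul, Matrix.trace_diagonal]
    rw [htr] at h5
    exact_mod_cast h5.symm
  have hcard : Fintype.card {i // μ i = 1} = k := by
    have h6 : ∀ i, μ i = 2 * (if μ i = 1 then 1 else 0) - 1 := by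
      intro i
      rcases hsq i with h | h <;> rw [h] <;> norm_num
    rw [Finset.sum_congr rfl fun i _ => h6 i] at htr2
    simp only [Finset.sum_sub_distrib, ← Finset.mul_sum, Finset.sum_boole, Finset.sum_const,
      Finset.card_univ, Fintype.card_fin, nsmul_eq_mul, mul_one] at htr2
    rw [Fintype.card_subtype]
    have : ((Finset.univ.filter fun i => μ i = 1).card : ℝ) = k := by linarith
    exact_mod_cast this
  let e : Fin k ≃ {i // μ i = 1} := (Fintype.equivFinOfCardEq hcard).symm
  refine ⟨V.submatrix id (fun j => (e j : Fin n)),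
    conjTranspose_submatrix_mul_submatrix hV (Subtype.val_injective.comp e.injective), ?_⟩
  ext i j
  have h7 : ∑ l : Fin k, V i (e l) * star (V j (e l)) =
      ∑ l, if μ l = 1 then V i l * star (V j l) else 0 := by
    rw [Equiv.sum_comp e (fun l => V i l * star (V j l)), ← Finset.sum_filter]
    exact (Finset.sum_subtype (Finset.univ.filter fun l => μ l = 1) (by simp)
      fun l => V i l * star (V j l)).symm
  have h8 : ∑ l, V i l * star (V j l) = (1 : Matrix (Fin n) (Fin n) ℂ) i j := by
    rw [← hV1]; rfl
  have h9 : X i j = ∑ l, V i l * μ l * star (V j l) := by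
    rw [hμ, Matrix.mul_apply]
    simp [Matrix.mul_diagonal]
  rw [Matrix.sub_apply, Matrix.smul_apply, Matrix.mul_apply, h9, ← h8]
  simp only [Matrix.submatrix_apply, id, Matrix.conjTranspose_apply, smul_eq_mul]
  rw [h7, Finset.mul_sum, ← Finset.sum_sub_distrib]
  refine Finset.sum_congr rfl fun l _ => ?_
  rcases hsq l with h | h <;> rw [h] <;> norm_num
  ring

/-! ### The spectrum of a product of two reflections -/

/-- Indices for the eigenvalues of a generic product: `p` conjugate pairs, the eigenvalue `-1` with
multiplicity `a` and the eigenvalue `1` with multiplicity `b`. -/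
abbrev SpectralIndex (p a b : ℕ) : Type := (Fin p ⊕ Fin p) ⊕ (Fin a ⊕ Fin b)

/-- The circle parameters of the eigenvalues of a product, from those of the upper half plane. -/
def spectralParam {p a b : ℕ} (s : Fin p → ℝ) : SpectralIndex p a b → ℝ :=
  Sum.elim (Sum.elim s fun j => -s j) (Sum.elim (fun _ => 1) fun _ => 0)

section Charpoly

variable {n k q : Type*} [Fintype n] [DecidableEq n] [Fintype k] [DecidableEq k]
  [Fintype q] [DecidableEq q]

theorem reflection_mul_self {A : Matrix n k ℂ} (hA : Aᴴ * A = 1) :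
    ((2 : ℂ) • (A * Aᴴ) - 1) * ((2 : ℂ) • (A * Aᴴ) - 1) = 1 := by
  have h : A * Aᴴ * (A * Aᴴ) = A * Aᴴ := by
    rw [Matrix.mul_assoc, ← Matrix.mul_assoc Aᴴ, hA, Matrix.one_mul]
  rw [Matrix.sub_mul, Matrix.mul_sub, Matrix.smul_mul, Matrix.mul_smul, h, Matrix.one_mul,
    Matrix.mul_one, smul_smul]
  module

/-- Since X² = 1, X(x - XY) = xX - Y = (1 - x) - LR with L = (A B). Exchanging L and R leaves a
small block matrix whose Schur complement involves only AᴴB. The powers of 1 ± x clear denominators.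
-/
theorem det_mul_eval_charpoly_reflections {A : Matrix n k ℂ} {B : Matrix n q ℂ}
    (hA : Aᴴ * A = 1) (hB : Bᴴ * B = 1) {x : ℂ} (hx : 1 + x ≠ 0) :
    ((2 : ℂ) • (A * Aᴴ) - 1).det *
      (((2 : ℂ) • (A * Aᴴ) - 1) * ((2 : ℂ) • (B * Bᴴ) - 1)).charpoly.eval x *
      (1 - x) ^ (Fintype.card k + Fintype.card q) * (1 + x) ^ Fintype.card q =
    (1 - x) ^ Fintype.card n * (1 + x) ^ Fintype.card k *
      ((4 * x) • ((Aᴴ * B)ᴴ * (Aᴴ * B)) - ((1 + x) ^ 2) • (1 : Matrix q q ℂ)).det := by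
  set X := (2 : ℂ) • (A * Aᴴ) - 1
  set Y := (2 : ℂ) • (B * Bᴴ) - 1
  have hXX : X * X = 1 := reflection_mul_self hA
  let L : Matrix n (k ⊕ q) ℂ := Matrix.fromCols A B
  let R : Matrix (k ⊕ q) n ℂ := Matrix.fromRows ((-2 * x) • Aᴴ) ((2 : ℂ) • Bᴴ)
  have e1 : X.det * (X * Y).charpoly.eval x = (L * R).charpoly.eval (1 - x) := by
    rw [Matrix.eval_charpoly, Matrix.eval_charpoly, ← Matrix.det_mul, Matrix.mul_sub,
      ← Matrix.mul_assoc, hXX, Matrix.one_mul, Matrix.fromCols_mul_fromRows]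
    congr 1
    rw [Matrix.scalar_apply, Matrix.scalar_apply, ← Matrix.smul_one_eq_diagonal,
      ← Matrix.smul_one_eq_diagonal, Matrix.mul_smul, Matrix.mul_smul, Matrix.mul_smul,
      Matrix.mul_one]
    simp only [X, Y]
    module
  have e2 : (R * L).charpoly.eval (1 - x) * (1 + x) ^ Fintype.card q = (1 + x) ^ Fintype.card k *
      ((4 * x) • ((Aᴴ * B)ᴴ * (Aᴴ * B)) - ((1 + x) ^ 2) • (1 : Matrix q q ℂ)).det := by
    have hBA : Bᴴ * A = (Aᴴ * B)ᴴ := by simp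
    have e3 : Matrix.scalar (k ⊕ q) (1 - x) - R * L = Matrix.fromBlocks ((1 + x) • 1)
        ((2 * x) • (Aᴴ * B)) ((-2 : ℂ) • (Aᴴ * B)ᴴ) (-(1 + x) • 1) := by
      rw [Matrix.fromRows_mul_fromCols, Matrix.smul_mul, Matrix.smul_mul, Matrix.smul_mul,
        Matrix.smul_mul, hA, hB, hBA, Matrix.scalar_apply, ← Matrix.smul_one_eq_diagonal,
        ← Matrix.fromBlocks_one, Matrix.fromBlocks_smul, sub_eq_add_neg,
        Matrix.fromBlocks_neg, Matrix.fromBlocks_add]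
      congr 1 <;> module
    have hinv : ((1 + x)⁻¹ • (1 : Matrix k k ℂ)) * ((1 + x) • 1) = 1 := by
      rw [Matrix.smul_mul, Matrix.mul_smul, smul_smul, inv_mul_cancel₀ hx, one_smul, Matrix.one_mul]
    let : Invertible ((1 + x) • (1 : Matrix k k ℂ)) :=
      ⟨(1 + x)⁻¹ • 1, hinv, mul_eq_one_comm.1 hinv⟩
    rw [Matrix.eval_charpoly, e3, Matrix.det_fromBlocks₁₁,
      show ⅟((1 + x) • (1 : Matrix k k ℂ)) = (1 + x)⁻¹ • 1 from rfl, Matrix.det_smul,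
      Matrix.det_one, mul_one, mul_assoc, mul_comm (Matrix.det _), ← Matrix.det_smul]
    congr 2
    simp only [Matrix.smul_mul, Matrix.mul_smul, Matrix.mul_one, smul_sub, smul_smul]
    have hc : (1 + x) * (2 * x * ((1 + x)⁻¹ * -2)) = -(4 * x) := by field_simp; ring
    rw [hc]
    module
  have e4 := congrArg (Polynomial.eval (1 - x)) (Matrix.charpoly_mul_comm' L R)
  simp only [Polynomial.eval_mul, Polynomial.eval_pow, Polynomial.eval_X, Fintype.card_sum] at e4
  rw [e1, mul_comm ((L * R).charpoly.eval _), e4, mul_assoc, e2]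
  ring

end Charpoly

/-- For γ = cos²θ the roots are exp(±2iθ), of real part 2γ - 1. -/
theorem exists_circleParam_quadratic {γ : ℝ} (h0 : 0 ≤ γ) (h1 : γ ≤ 1) :
    ∃ s, ∀ x : ℂ, (1 + x) ^ 2 - 4 * x * γ = (x - circleParam s) * (x - circleParam (-s)) := by
  have hr : (Real.sqrt (1 - (2 * γ - 1) ^ 2)) ^ 2 = 1 - (2 * γ - 1) ^ 2 :=
    Real.sq_sqrt (by nlinarith)
  obtain ⟨s, hs⟩ := exists_circleParam_eq
    (z := ⟨2 * γ - 1, Real.sqrt (1 - (2 * γ - 1) ^ 2)⟩) (by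
      rw [← pow_eq_one_iff_of_nonneg (norm_nonneg _) two_ne_zero, ← Complex.normSq_eq_norm_sq,
        Complex.normSq_mk]
      linarith)
  refine ⟨s, fun x => ?_⟩
  have h2 : circleParam s * circleParam (-s) = 1 := by
    rw [← star_circleParam, circleParam_mul_star]
  have h3 : circleParam s + circleParam (-s) = 4 * γ - 2 := by
    rw [← star_circleParam, hs]
    apply Complex.ext <;> simp
    ring
  linear_combination x * h3 - h2

-- The eigenvalues of CᴴC, C = AᴴB, lie in [0, 1] because 1 - CᴴC = Bᴴ(1 - AAᴴ)B and 1 - AAᴴ is an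
-- orthogonal projection. Each one contributes a conjugate pair.
open scoped ComplexOrder in
theorem exists_gram_contraction_det {n k q : Type*} [Fintype n] [DecidableEq n]
    [Fintype k] [DecidableEq k] [Fintype q] [DecidableEq q] {A : Matrix n k ℂ} {B : Matrix n q ℂ}
    (hA : Aᴴ * A = 1) (hB : Bᴴ * B = 1) :
    ∃ s : q → ℝ, ∀ x : ℂ,
      ((4 * x) • ((Aᴴ * B)ᴴ * (Aᴴ * B)) - ((1 + x) ^ 2) • (1 : Matrix q q ℂ)).det =
      (-1) ^ Fintype.card q * ∏ j, ((x - circleParam (s j)) * (x - circleParam (-s j))) := by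
  set C := Aᴴ * B with hC
  obtain ⟨W, hW, γ, hγ⟩ :=
    (Matrix.isHermitian_conjTranspose_mul_self C).exists_unitary_diagonalization
  have hW1 : W * Wᴴ = 1 := Matrix.mem_unitaryGroup_iff.1 hW
  have hW2 : Wᴴ * W = 1 := Matrix.mem_unitaryGroup_iff'.1 hW
  have hD : Wᴴ * (Cᴴ * C) * W = Matrix.diagonal (fun i => (γ i : ℂ)) := by
    rw [hγ]
    simp only [Matrix.mul_assoc, hW2, Matrix.mul_one]
    rw [← Matrix.mul_assoc, hW2, Matrix.one_mul]
  have h0 : ∀ j, 0 ≤ γ j := by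
    have h := (Matrix.posSemidef_conjTranspose_mul_self C).conjTranspose_mul_mul_same W
    rw [hD, Matrix.posSemidef_diagonal_iff] at h
    exact fun j => by simpa using h j
  have h1 : ∀ j, γ j ≤ 1 := by
    have hP : (1 - A * Aᴴ)ᴴ * (1 - A * Aᴴ) = 1 - A * Aᴴ := by
      have : A * Aᴴ * (A * Aᴴ) = A * Aᴴ := by
        rw [Matrix.mul_assoc, ← Matrix.mul_assoc Aᴴ, hA, Matrix.one_mul]
      simp [Matrix.sub_mul, Matrix.mul_sub, this]
    have h := ((Matrix.posSemidef_conjTranspose_mul_self (1 - A * Aᴴ)).conjTranspose_mul_mul_same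
      B).conjTranspose_mul_mul_same W
    have hBB : Bᴴ * (1 - A * Aᴴ) * B = 1 - Cᴴ * C := by
      rw [Matrix.mul_sub, Matrix.sub_mul, Matrix.mul_one, hB, hC]
      simp [Matrix.mul_assoc]
    rw [hP, hBB, Matrix.mul_sub, Matrix.sub_mul, Matrix.mul_one, hW2, hD, ← Matrix.diagonal_one,
      Matrix.diagonal_sub, Matrix.posSemidef_diagonal_iff] at h
    intro j
    have := h j
    rw [sub_nonneg] at this
    exact_mod_cast this
  choose s hs using fun j => exists_circleParam_quadratic (h0 j) (h1 j)
  refine ⟨s, fun x => ?_⟩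
  have e : (4 * x) • (Cᴴ * C) - ((1 + x) ^ 2) • (1 : Matrix q q ℂ) =
      W * Matrix.diagonal (fun j => -((x - circleParam (s j)) * (x - circleParam (-s j)))) * Wᴴ := by
    have e2 : Matrix.diagonal (fun j => -((x - circleParam (s j)) * (x - circleParam (-s j)))) =
        (4 * x) • Matrix.diagonal (fun i => (γ i : ℂ)) - ((1 + x) ^ 2) • 1 := by
      rw [Matrix.smul_one_eq_diagonal, ← Matrix.diagonal_smul, Matrix.diagonal_sub]
      congr 1
      ext j
      rw [← hs]
      simp
    rw [e2, Matrix.mul_sub, Matrix.sub_mul, Matrix.mul_smul, Matrix.smul_mul, ← hγ,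
      Matrix.mul_smul, Matrix.smul_mul, Matrix.mul_one, hW1]
  rw [e, Matrix.det_mul, Matrix.det_mul, mul_comm, ← mul_assoc, ← Matrix.det_mul, hW2,
    Matrix.det_one, one_mul, Matrix.det_diagonal, Finset.prod_neg]
  rfl

theorem exists_unitary_eq_of_mul {n p a b : ℕ} (e₀ : Fin n ≃ SpectralIndex p a b)
    {X Y : Matrix (Fin n) (Fin n) ℂ} (hX : X ∈ complexGrassmannian (p + a) n)
    (hY : Y ∈ complexGrassmannian p n) :
    ∃ U ∈ Matrix.unitaryGroup (Fin n) ℂ, ∃ s : Fin p → ℝ,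
      X * Y = U * Matrix.diagonal (fun i => circleParam (spectralParam s (e₀ i))) * Uᴴ := by
  have hn : n = (p + p) + (a + b) := by simpa using Fintype.card_congr e₀
  obtain ⟨V, hV, μ, hμ⟩ := exists_unitary_diagonalization_of_mem_unitaryGroup
    (mul_mem hX.1 hY.1)
  have hVV : Vᴴ * V = 1 := Matrix.mem_unitaryGroup_iff'.1 hV
  obtain ⟨A, hA, hXA⟩ := exists_isometry_of_mem_complexGrassmannian hX
  obtain ⟨B, hB, hYB⟩ := exists_isometry_of_mem_complexGrassmannian hY
  obtain ⟨s, hs⟩ := exists_gram_contraction_det hA hB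
  have hXX : X * X = 1 := hXA ▸ reflection_mul_self hA
  have hdet : X.det ≠ 0 := fun h => by
    have := congrArg Matrix.det hXX
    rw [Matrix.det_mul, h, zero_mul, Matrix.det_one] at this
    exact zero_ne_one this
  let lam : Fin n → ℂ := fun i => circleParam (spectralParam s (e₀ i))
  have hchar : (X * Y).charpoly = ∏ i, (Polynomial.X - Polynomial.C (μ i)) := by
    rw [hμ, Matrix.charpoly_mul_comm, ← Matrix.mul_assoc, hVV, Matrix.one_mul,
      Matrix.charpoly_diagonal]
  have hprod : ∀ x : ℂ, ∏ i, (x - lam i) =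
      (∏ j, ((x - circleParam (s j)) * (x - circleParam (-s j)))) * ((x + 1) ^ a * (x - 1) ^ b) := by
    intro x
    rw [Equiv.prod_comp e₀ fun i => x - circleParam (spectralParam s i)]
    simp [Fintype.prod_sum_type, spectralParam, circleParam_zero, circleParam_one,
      Finset.prod_mul_distrib]
  have hpoly : Polynomial.C X.det * (X * Y).charpoly =
      Polynomial.C ((-1) ^ p * (-1) ^ b) * ∏ i, (Polynomial.X - Polynomial.C (lam i)) := by
    refine Polynomial.eq_of_infinite_eval_eq _ _
      (Set.Infinite.mono ?_ (Set.Finite.infinite_compl (Set.toFinite {(1 : ℂ), -1})))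
    intro x hx
    simp only [Set.mem_compl_iff, Set.mem_insert_iff, Set.mem_singleton_iff, not_or] at hx
    have hx1 : 1 - x ≠ 0 := fun h => hx.1 (by linear_combination -h)
    have hx2 : 1 + x ≠ 0 := fun h => hx.2 (by linear_combination h)
    have h := det_mul_eval_charpoly_reflections hA hB hx2
    rw [← hXA, ← hYB, hs] at h
    simp only [Fintype.card_fin] at h
    simp only [Set.mem_ofPred_eq, Polynomial.eval_mul, Polynomial.eval_C, Polynomial.eval_prod,
      Polynomial.eval_sub, Polynomial.eval_X]
    rw [hprod]
    have hne : (1 - x) ^ (p + a + p) * (1 + x) ^ p ≠ 0 :=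
      mul_ne_zero (pow_ne_zero _ hx1) (pow_ne_zero _ hx2)
    apply mul_right_cancel₀ hne
    rw [← mul_assoc, h]
    have e1 : (1 - x) ^ n = (1 - x) ^ (p + a + p) * ((-1) ^ b * (x - 1) ^ b) := by
      rw [← mul_pow, ← show 1 - x = -1 * (x - 1) by ring, ← pow_add]
      congr 1; omega
    rw [e1, pow_add (1 + x), add_comm x 1]
    ring
  -- Roots ignore nonzero constants, so det X need not be computed.
  have hroots : Finset.univ.val.map μ = Finset.univ.val.map lam := by
    have hr : ∀ ν : Fin n → ℂ, (∏ i, (Polynomial.X - Polynomial.C (ν i))).roots =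
        Finset.univ.val.map ν := fun ν => by
      rw [← Polynomial.roots_multiset_prod_X_sub_C (Finset.univ.val.map ν), Multiset.map_map]
      rfl
    have h := congrArg Polynomial.roots hpoly
    rw [Polynomial.roots_C_mul _ hdet, Polynomial.roots_C_mul _ (by simp), hchar,
      hr, hr] at h
    exact h
  obtain ⟨e, he⟩ := exists_equiv_of_map_univ_eq hroots
  refine ⟨V.submatrix id e.symm, ?_, s, ?_⟩
  · rw [Matrix.mem_unitaryGroup_iff', Matrix.star_eq_conjTranspose]
    exact conjTranspose_submatrix_mul_submatrix hV e.symm.injective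
  · rw [hμ, he]
    have hd : Matrix.diagonal (lam ∘ e) = (Matrix.diagonal lam).submatrix e e := by
      rw [Matrix.submatrix_diagonal_equiv]
    have h1 : V = (V.submatrix id e.symm).submatrix id e := by simp
    have h2 : Vᴴ = ((V.submatrix id e.symm)ᴴ).submatrix e id := by simp
    rw [hd, h2]
    nth_rw 1 [h1]
    rw [Matrix.submatrix_mul_equiv, Matrix.submatrix_mul_equiv, Matrix.submatrix_id_id]

/-! ### Conjugates of generic products are products -/

theorem conj_submatrix_mem_complexGrassmannian {n k : ℕ} {ι : Type*} [Fintype ι] [DecidableEq ι]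
    (e₀ : Fin n ≃ ι) {V : Matrix (Fin n) (Fin n) ℂ} (hV : V ∈ Matrix.unitaryGroup (Fin n) ℂ)
    {W : Matrix ι ι ℂ} (hW : Wᴴ = W) (hWW : W * W = 1) (htr : W.trace = 2 * (k : ℂ) - n) :
    V * W.submatrix e₀ e₀ * Vᴴ ∈ complexGrassmannian k n := by
  have hV2 : Vᴴ * V = 1 := Matrix.mem_unitaryGroup_iff'.1 hV
  have hV1 : V * Vᴴ = 1 := Matrix.mem_unitaryGroup_iff.1 hV
  have hsq : V * W.submatrix e₀ e₀ * Vᴴ * (V * W.submatrix e₀ e₀ * Vᴴ) = 1 := by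
    calc _ = V * W.submatrix e₀ e₀ * (Vᴴ * V) * W.submatrix e₀ e₀ * Vᴴ := by
          simp only [Matrix.mul_assoc]
      _ = V * (W.submatrix e₀ e₀ * W.submatrix e₀ e₀) * Vᴴ := by
          rw [hV2, Matrix.mul_one]; simp only [Matrix.mul_assoc]
      _ = 1 := by rw [Matrix.submatrix_mul_equiv, hWW, Matrix.submatrix_one_equiv,
          Matrix.mul_one, hV1]
  refine ⟨?_, by rw [sq, hsq], ?_⟩
  · rw [Matrix.mem_unitaryGroup_iff, Matrix.star_eq_conjTranspose]
    have : (V * W.submatrix e₀ e₀ * Vᴴ)ᴴ = V * W.submatrix e₀ e₀ * Vᴴ := by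
      simp [Matrix.conjTranspose_mul, Matrix.conjTranspose_submatrix, hW, Matrix.mul_assoc]
    rw [this, hsq]
  · rw [Matrix.trace_mul_cycle, hV2, Matrix.one_mul, ← htr]
    exact Equiv.sum_comp e₀ fun i => W i i

/-- On each plane of a conjugate pair, diag(z, conj z) is a product of two traceless reflections.
Elsewhere X₀ is 1 on the a-part and -1 on the b-part while Y₀ = -1, which gives the traces a - b and
-(a + b). -/
theorem conj_diagonal_mem_grassmannianProduct {n p a b : ℕ} (e₀ : Fin n ≃ SpectralIndex p a b)
    {V : Matrix (Fin n) (Fin n) ℂ} (hV : V ∈ Matrix.unitaryGroup (Fin n) ℂ) (s : Fin p → ℝ) :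
    V * Matrix.diagonal (fun i => circleParam (spectralParam s (e₀ i))) * Vᴴ ∈
      grassmannianProduct (p + a) p n := by
  have hn : (n : ℂ) = (p + p) + (a + b) := by
    exact_mod_cast (by simpa using Fintype.card_congr e₀ : n = (p + p) + (a + b))
  have hV2 : Vᴴ * V = 1 := Matrix.mem_unitaryGroup_iff'.1 hV
  let D : Matrix (Fin p) (Fin p) ℂ := Matrix.diagonal fun j => circleParam (s j)
  let D' : Matrix (Fin p) (Fin p) ℂ := Matrix.diagonal fun j => circleParam (-s j)
  have hD : Dᴴ = D' := by
    rw [Matrix.diagonal_conjTranspose]; congr 1; ext j; exact star_circleParam _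
  have hD' : D'ᴴ = D := by rw [← hD, Matrix.conjTranspose_conjTranspose]
  have hDD : D * D' = 1 := by
    rw [Matrix.diagonal_mul_diagonal, ← Matrix.diagonal_one]
    congr 1; ext j; rw [← star_circleParam, circleParam_mul_star]
  have hDD' : D' * D = 1 := mul_eq_one_comm.1 hDD
  let X₀ : Matrix (SpectralIndex p a b) (SpectralIndex p a b) ℂ :=
    Matrix.fromBlocks (Matrix.fromBlocks 0 1 1 0) 0 0 (Matrix.fromBlocks 1 0 0 (-1))
  let Y₀ : Matrix (SpectralIndex p a b) (SpectralIndex p a b) ℂ :=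
    Matrix.fromBlocks (Matrix.fromBlocks 0 D' D 0) 0 0 (-1)
  have hXY : X₀ * Y₀ = Matrix.diagonal fun i => circleParam (spectralParam s i) := by
    have h1 : (fun i => circleParam (spectralParam (a := a) (b := b) s i)) =
        Sum.elim (Sum.elim (fun j => circleParam (s j)) fun j => circleParam (-s j))
          (Sum.elim (fun _ => -1) fun _ => 1) := by
      ext ((j | j) | (j | j)) <;> simp [spectralParam, circleParam_zero, circleParam_one]
    rw [h1, ← Matrix.fromBlocks_diagonal, ← Matrix.fromBlocks_diagonal,
      ← Matrix.fromBlocks_diagonal]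
    simp only [X₀, Y₀, Matrix.fromBlocks_multiply]
    simp only [Matrix.zero_mul, Matrix.mul_zero, Matrix.one_mul, zero_add, add_zero,
      Matrix.mul_neg, Matrix.mul_one, Matrix.fromBlocks_neg, neg_neg, neg_zero]
    congr 2
    rw [← Matrix.diagonal_one, Matrix.diagonal_neg]
  refine ⟨V * X₀.submatrix e₀ e₀ * Vᴴ, conj_submatrix_mem_complexGrassmannian e₀ hV ?_ ?_ ?_,
    V * Y₀.submatrix e₀ e₀ * Vᴴ, conj_submatrix_mem_complexGrassmannian e₀ hV ?_ ?_ ?_, ?_⟩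
  · simp [X₀, Matrix.fromBlocks_conjTranspose]
  · simp [X₀, Matrix.fromBlocks_multiply, Matrix.fromBlocks_one]
  · simp [X₀, Matrix.trace, Fintype.sum_sum_type, hn]; ring
  · simp [Y₀, Matrix.fromBlocks_conjTranspose, hD, hD']
  · simp [Y₀, Matrix.fromBlocks_multiply, hDD, hDD', Matrix.fromBlocks_one]
  · simp [Y₀, Matrix.trace, Fintype.sum_sum_type, hn]; ring
  · calc _ = V * (X₀ * Y₀).submatrix e₀ e₀ * Vᴴ := by
          rw [hXY, Matrix.submatrix_diagonal_equiv]; rfl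
      _ = V * X₀.submatrix e₀ e₀ * (Vᴴ * V) * Y₀.submatrix e₀ e₀ * Vᴴ := by
          rw [hV2, Matrix.mul_one, ← Matrix.submatrix_mul_equiv _ _ _ e₀]
          simp only [Matrix.mul_assoc]
      _ = _ := by simp only [Matrix.mul_assoc]

/-! ### The derivative of the Cayley transform -/

attribute [local instance] Matrix.linftyOpNormedRing Matrix.linftyOpNormedAlgebra

/-- At a scalar matrix everything commutes, so the derivative is that of (1 - t)/(1 + t). It is used
at t = 0 and t = 1. -/
theorem hasStrictFDerivAt_cayley {m : Type*} [Fintype m] [DecidableEq m] (t : ℂ)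
    (ht : 1 + t ≠ 0) {c : ℝ} (hc : (c : ℂ) = -2 * ((1 + t)⁻¹) ^ 2) :
    HasStrictFDerivAt (cayley : Matrix m m ℂ → Matrix m m ℂ)
      (c • ContinuousLinearMap.id ℝ (Matrix m m ℂ)) (t • 1) := by
  have e : (1 : Matrix m m ℂ) + t • 1 = (1 + t) • 1 := by rw [add_smul, one_smul]
  have h1 : ((1 + t) • (1 : Matrix m m ℂ)) * ((1 + t)⁻¹ • 1) = 1 := by
    rw [Matrix.smul_mul, Matrix.mul_smul, smul_smul, mul_inv_cancel₀ ht, one_smul, Matrix.one_mul]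
  let u : (Matrix m m ℂ)ˣ := ⟨(1 + t) • 1, (1 + t)⁻¹ • 1, h1, mul_eq_one_comm.1 h1⟩
  have hinv : HasStrictFDerivAt (fun H : Matrix m m ℂ => (1 + H)⁻¹)
      (-ContinuousLinearMap.mulLeftRight ℝ (Matrix m m ℂ) (↑u⁻¹) (↑u⁻¹)) (t • 1) := by
    have h := hasStrictFDerivAt_ringInverse (𝕜 := ℝ) u
    have h2 : HasStrictFDerivAt (fun H : Matrix m m ℂ => 1 + H)
        (ContinuousLinearMap.id ℝ (Matrix m m ℂ)) (t • 1) := (hasStrictFDerivAt_id _).const_add 1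
    have h3 : (u : Matrix m m ℂ) = 1 + t • 1 := e.symm
    rw [h3] at h
    have h4 : (fun H : Matrix m m ℂ => (1 + H)⁻¹) = Ring.inverse ∘ fun H => 1 + H := by
      ext1 H; exact Matrix.nonsing_inv_eq_ringInverse _
    rw [h4]
    exact (h.comp _ h2).congr_fderiv (ContinuousLinearMap.comp_id _)
  have hsub : HasStrictFDerivAt (fun H : Matrix m m ℂ => 1 - H)
      (-ContinuousLinearMap.id ℝ (Matrix m m ℂ)) (t • 1) := (hasStrictFDerivAt_id _).const_sub 1
  refine (hsub.mul' hinv).congr_fderiv ?_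
  ext1 X
  change (1 - t • 1) * (-(((1 + t)⁻¹ • 1) * X * ((1 + t)⁻¹ • 1))) +
    (-X) * (1 + t • (1 : Matrix m m ℂ))⁻¹ = c • X
  have e2 : (1 + t • (1 : Matrix m m ℂ))⁻¹ = (1 + t)⁻¹ • 1 := by
    rw [e]; exact Matrix.inv_eq_right_inv h1
  have e3 : (1 : Matrix m m ℂ) - t • 1 = (1 - t) • 1 := by rw [sub_smul, one_smul]
  have e4 : c • X = (c : ℂ) • X := by ext i j; simp
  rw [e2, e3, e4, hc]
  simp only [Matrix.smul_mul, Matrix.mul_smul, Matrix.one_mul, Matrix.mul_one,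
    smul_smul, smul_neg, ← neg_smul, ← add_smul]
  congr 1
  field_simp
  ring

section LocalSurjectivity

variable {m : Type*} [Fintype m] [DecidableEq m]

/-- The part of a family of real coordinates that is supported on `J`. -/
noncomputable def restrictTo (J : Set (m × m)) : (m × m → ℝ) →ₗ[ℝ] (m × m → ℝ) where
  toFun R := J.indicator R
  map_add' R S := Set.indicator_add J R S
  map_smul' c R := Set.indicator_const_smul J c R

/-- Near the identity, a unitary matrix is a product of Cayley transforms of skew-Hermitian matrices
that are supported on `J` and on the complement of `J`. -/
theorem eventually_exists_cayley_eq_mul (J : Set (m × m)) :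
    ∀ᶠ R : m × m → ℝ in nhds 0, ∃ R' : m × m → ℝ,
      cayley (skewOfReal R) = cayley (skewOfReal (restrictTo J R')) *
        cayley (skewOfReal (restrictTo Jᶜ R')) := by
  let g (K : Set (m × m)) : (m × m → ℝ) →L[ℝ] Matrix m m ℂ :=
    LinearMap.toContinuousLinearMap (skewOfReal ∘ₗ restrictTo K)
  let r : Matrix m m ℂ →L[ℝ] (m × m → ℝ) := LinearMap.toContinuousLinearMap realOfSkew
  have hc : ∀ K, HasStrictFDerivAt (fun R => cayley (g K R)) ((-2 : ℝ) • g K) 0 := by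
    intro K
    have h := hasStrictFDerivAt_cayley (m := m) 0 (by simp) (c := -2) (by simp)
    rw [zero_smul, ← map_zero (g K)] at h
    have := h.comp 0 (g K).hasStrictFDerivAt
    exact this.congr_fderiv (by ext1 v; rfl)
  have hc0 : ∀ K, cayley (g K 0) = 1 := fun K => by
    rw [map_zero, cayley, sub_zero, add_zero, inv_one, Matrix.one_mul]
  have hm : HasStrictFDerivAt (fun R => cayley (g J R) * cayley (g Jᶜ R))
      ((-2 : ℝ) • (g J + g Jᶜ)) 0 := by
    refine ((hc J).mul' (hc Jᶜ)).congr_fderiv ?_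
    ext1 v
    change cayley (g J 0) * ((-2 : ℝ) • g Jᶜ v) + ((-2 : ℝ) • g J v) * cayley (g Jᶜ 0) =
      (-2 : ℝ) • (g J v + g Jᶜ v)
    rw [hc0, hc0, Matrix.one_mul, Matrix.mul_one, smul_add, add_comm]
  have hg : r ∘L (g J + g Jᶜ) = ContinuousLinearMap.id ℝ _ := by
    ext1 v
    have : restrictTo J v + restrictTo Jᶜ v = v := Set.indicator_self_add_compl J v
    change realOfSkew (skewOfReal (restrictTo J v) + skewOfReal (restrictTo Jᶜ v)) = v
    rw [← map_add, this, realOfSkew_skewOfReal]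
  -- In skew-Hermitian coordinates the product map has derivative (-1/2)(-2) = 1 at 0, hence is
  -- locally onto.
  have hF : HasStrictFDerivAt (fun R => r (cayley (cayley (g J R) * cayley (g Jᶜ R))))
      (ContinuousLinearMap.id ℝ (m × m → ℝ)) 0 := by
    have h := hasStrictFDerivAt_cayley (m := m) 1 (by norm_num) (c := -(1 / 2))
      (by norm_num)
    have h1 : (1 : ℂ) • (1 : Matrix m m ℂ) = cayley (g J 0) * cayley (g Jᶜ 0) := by
      rw [hc0, hc0, one_smul, Matrix.one_mul]
    rw [h1] at h
    have h2 := r.hasStrictFDerivAt.comp 0 (h.comp 0 hm)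
    refine h2.congr_fderiv ?_
    rw [← hg]
    ext1 v
    change r ((-(1 / 2) : ℝ) • ((-2 : ℝ) • (g J v + g Jᶜ v))) = r (g J v + g Jᶜ v)
    rw [smul_smul]
    norm_num
  have hF0 : r (cayley (cayley (g J 0) * cayley (g Jᶜ 0))) = 0 := by
    rw [hc0, hc0, Matrix.one_mul, cayley, sub_self, Matrix.zero_mul, map_zero]
  have hdet : ∀ᶠ R in nhds (0 : m × m → ℝ),
      IsUnit (1 + cayley (g J R) * cayley (g Jᶜ R)).det := by
    have hcont : ContinuousAt (fun R => (1 + cayley (g J R) * cayley (g Jᶜ R)).det) 0 :=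
      (Continuous.matrix_det continuous_id).continuousAt.comp
        (continuousAt_const.add hm.continuousAt)
    refine (hcont.eventually_ne ?_).mono fun R hR => isUnit_iff_ne_zero.2 hR
    rw [hc0, hc0, Matrix.one_mul, ← two_smul ℂ (1 : Matrix m m ℂ), Matrix.det_smul]
    simp
  have hmap := hF.map_nhds_eq_of_surj (by
    rw [LinearMap.range_eq_top]; exact Function.surjective_id)
  rw [hF0] at hmap
  rw [← hmap, Filter.eventually_map]
  filter_upwards [hdet] with R hR
  refine ⟨R, ?_⟩
  have hs : ∀ K, (g K R)ᴴ = -g K R := fun K => conjTranspose_skewOfReal _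
  have hU := mul_mem (cayley_mem_unitaryGroup (hs J)) (cayley_mem_unitaryGroup (hs Jᶜ))
  have h3 : skewOfReal (r (cayley (cayley (g J R) * cayley (g Jᶜ R)))) =
      cayley (cayley (g J R) * cayley (g Jᶜ R)) :=
    skewOfReal_realOfSkew (conjTranspose_cayley_of_mem_unitaryGroup hU hR)
  rw [h3, cayley_cayley hR]
  rfl

end LocalSurjectivity

/-! ### The eigenvalue pattern of a generic product -/

section Pattern

variable {n p a b : ℕ}

/-- The eigenspace of a generic product to which an index belongs. -/
def blockOf : SpectralIndex p a b → (Fin p ⊕ Fin p) ⊕ Bool :=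
  Sum.map id (Sum.elim (fun _ => true) fun _ => false)

theorem spectralParam_eq_of_blockOf_eq (s : Fin p → ℝ) {i j : SpectralIndex p a b}
    (h : blockOf i = blockOf j) : spectralParam s i = spectralParam s j := by
  rcases i with (i | i) | (i | i) <;> rcases j with (j | j) | (j | j) <;>
    simp_all [blockOf, spectralParam]

/-- Parameters of pairwise different eigenvalues in the open upper half plane. -/
noncomputable def genericParam (j : Fin p) : ℝ := ((j : ℝ) + 2)⁻¹

theorem genericParam_pos (j : Fin p) : 0 < genericParam j := by unfold genericParam; positivity

theorem genericParam_lt_one (j : Fin p) : genericParam j < 1 :=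
  inv_lt_one_of_one_lt₀ (by linarith [Nat.cast_nonneg (α := ℝ) (j : ℕ)])

theorem genericParam_injective : Function.Injective (genericParam (p := p)) := by
  intro i j h
  have := inv_injective h
  ext
  exact_mod_cast add_right_cancel this

/-- All parameters lie where `circleParam` is injective; as the generic ones lie strictly between 0
and 1, their negatives, 0 and 1 are separate. -/
theorem circleParam_genericParam_ne {i j : SpectralIndex p a b} (h : blockOf i ≠ blockOf j) :
    circleParam (spectralParam genericParam i) ≠ circleParam (spectralParam genericParam j) := by
  have hI : ∀ i : SpectralIndex p a b, spectralParam genericParam i ∈ Set.Ioc (-1 : ℝ) 1 := by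
    rintro ((i | i) | (i | i)) <;> simp only [spectralParam, Sum.elim_inl, Sum.elim_inr] <;>
      constructor <;> linarith [genericParam_pos i, genericParam_lt_one i]
  refine fun h2 => h ?_
  have h3 := circleParam_injOn (hI i) (hI j) h2
  rcases i with (i | i) | (i | i) <;> rcases j with (j | j) | (j | j) <;>
    simp only [spectralParam, Sum.elim_inl, Sum.elim_inr] at h3 <;>
    first
    | rfl
    | rw [genericParam_injective h3]
    | rw [genericParam_injective (neg_injective h3)]
    | (exfalso; linarith [genericParam_pos i, genericParam_lt_one i, genericParam_pos j,
        genericParam_lt_one j])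

/-- The matrix positions outside of the diagonal blocks of the eigenspaces. -/
def offBlocks (e₀ : Fin n ≃ SpectralIndex p a b) : Set (Fin n × Fin n) :=
  {q | blockOf (e₀ q.1) ≠ blockOf (e₀ q.2)}

/-- The diagonal blocks are 2p of size 1, one of size a and one of size b. -/
theorem card_offBlocks (e₀ : Fin n ≃ SpectralIndex p a b) :
    Nat.card (offBlocks e₀) + (p + p + (a * a + b * b)) = n * n := by
  classical
  have h1 : Nat.card (offBlocks e₀) = ∑ i : SpectralIndex p a b, ∑ j : SpectralIndex p a b,
      if blockOf i = blockOf j then 0 else 1 := by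
    rw [← Fintype.sum_prod_type']
    rw [← Equiv.sum_comp (e₀.prodCongr e₀), Nat.card_eq_fintype_card, Fintype.card_subtype]
    rw [Finset.card_filter]
    refine Finset.sum_congr rfl fun q _ => ?_
    by_cases hq : blockOf (e₀ q.1) = blockOf (e₀ q.2) <;> simp [offBlocks, hq]
  have h2 : p + p + (a * a + b * b) = ∑ i : SpectralIndex p a b, ∑ j : SpectralIndex p a b,
      if blockOf i = blockOf j then 1 else 0 := by
    simp [Fintype.sum_sum_type, blockOf, Finset.filter_eq]
  have hn : n = Fintype.card (SpectralIndex p a b) := by simpa using Fintype.card_congr e₀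
  rw [h1, h2, ← Finset.sum_add_distrib]
  conv_rhs => rw [hn]
  have : ∀ i j : SpectralIndex p a b, ((if blockOf i = blockOf j then 0 else 1) +
      if blockOf i = blockOf j then 1 else 0) = 1 := fun i j => by split_ifs <;> rfl
  simp only [← Finset.sum_add_distrib, this]
  simp

end Pattern

/-! ### The rational parametrization -/

section Parametrization

variable {n p a b : ℕ} (e₀ : Fin n ≃ SpectralIndex p a b)

/-- The diagonal matrix of the eigenvalues with given circle parameters. -/
noncomputable def eigenvalueMatrix (s : Fin p → ℝ) : Matrix (Fin n) (Fin n) ℂ :=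
  Matrix.diagonal fun i => circleParam (spectralParam s (e₀ i))

/-- The real coordinates of a generic product. -/
abbrev ParamIndex : Type := offBlocks e₀ ⊕ Fin p

/-- The skew-Hermitian matrix with given coordinates outside of the diagonal blocks. -/
noncomputable def skewPart : (ParamIndex e₀ → ℝ) →ₗ[ℝ] Matrix (Fin n) (Fin n) ℂ :=
  skewOfReal ∘ₗ Function.ExtendByZero.linearMap ℝ Subtype.val ∘ₗ LinearMap.funLeft ℝ ℝ Sum.inl

/-- The rational parametrization of the generic products. -/
noncomputable def productParam (x : ParamIndex e₀ → ℝ) : Matrix (Fin n) (Fin n) ℂ :=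
  cayley (skewPart e₀ x) * eigenvalueMatrix e₀ (x ∘ Sum.inr) * cayley (-skewPart e₀ x)

theorem conjTranspose_skewPart (x : ParamIndex e₀ → ℝ) : (skewPart e₀ x)ᴴ = -skewPart e₀ x :=
  conjTranspose_skewOfReal _

theorem isRegularFun_spectralParam {τ : Type*} {s : (τ → ℝ) → Fin p → ℝ}
    (hs : ∀ j, IsRegularFun fun t => s t j) (i : SpectralIndex p a b) :
    IsRegularFun fun t => spectralParam (s t) i := by
  rcases i with (i | i) | (i | i)
  · exact hs i
  · exact (hs i).neg
  · exact .const 1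
  · exact .const 0

theorem isRegularMatrixFun_conj {τ : Type*} {H : (τ → ℝ) → Matrix (Fin n) (Fin n) ℂ}
    (hH : IsRegularMatrixFun H) (hs : ∀ t, (H t)ᴴ = -H t) {s : (τ → ℝ) → Fin p → ℝ}
    (hsp : ∀ j, IsRegularFun fun t => s t j) :
    IsRegularMatrixFun fun t => cayley (H t) * eigenvalueMatrix e₀ (s t) * cayley (-H t) :=
  ((hH.cayley hs).mul (.diagonal fun i =>
    isRegularComplexFun_circleParam (isRegularFun_spectralParam hsp (e₀ i)))).mul
    (hH.neg.cayley fun t => by rw [Matrix.conjTranspose_neg, hs])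

theorem isRegularFun_realCoords {τ : Type*} {A : (τ → ℝ) → Matrix (Fin n) (Fin n) ℂ}
    (hA : IsRegularMatrixFun A) (i : (Fin n × Fin n) ⊕ (Fin n × Fin n)) :
    IsRegularFun fun t => realCoords (A t) i := by
  rcases i with i | i
  · exact (hA _ _).1
  · exact (hA _ _).2

theorem isRegularMatrixFun_skewPart : IsRegularMatrixFun fun x => skewPart e₀ x := by
  refine isRegularMatrixFun_skewOfReal fun q => ?_
  by_cases hq : q ∈ offBlocks e₀
  · have : ∀ x : ParamIndex e₀ → ℝ, Function.ExtendByZero.linearMap ℝ Subtype.val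
        (LinearMap.funLeft ℝ ℝ Sum.inl x) q = x (Sum.inl ⟨q, hq⟩) := fun x =>
      Subtype.val_injective.extend_apply (fun i => x (Sum.inl i)) 0 ⟨q, hq⟩
    simpa only [LinearMap.comp_apply, this] using IsRegularFun.coord _
  · have : ∀ x : ParamIndex e₀ → ℝ, Function.ExtendByZero.linearMap ℝ Subtype.val
        (LinearMap.funLeft ℝ ℝ Sum.inl x) q = 0 := fun x =>
      Function.extend_apply' _ _ _ (by rintro ⟨i, rfl⟩; exact hq i.2)
    simpa only [LinearMap.comp_apply, this] using IsRegularFun.const 0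

theorem productParam_mem (x : ParamIndex e₀ → ℝ) :
    productParam e₀ x ∈ grassmannianProduct (p + a) p n := by
  rw [productParam, ← conjTranspose_cayley (conjTranspose_skewPart e₀ x)]
  exact conj_diagonal_mem_grassmannianProduct e₀
    (cayley_mem_unitaryGroup (conjTranspose_skewPart e₀ x)) _

/-! ### Zariski density of the parametrization -/

/-- D(s) is scalar on each block, for every s; accidental coincidences of eigenvalues do no harm. -/
theorem skewOfReal_restrictTo_compl_mul_eigenvalueMatrix (R : Fin n × Fin n → ℝ)
    (s : Fin p → ℝ) :
    skewOfReal (restrictTo (offBlocks e₀)ᶜ R) * eigenvalueMatrix e₀ s =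
      eigenvalueMatrix e₀ s * skewOfReal (restrictTo (offBlocks e₀)ᶜ R) := by
  ext i j
  rw [eigenvalueMatrix, Matrix.mul_diagonal, Matrix.diagonal_mul]
  by_cases h : blockOf (e₀ i) = blockOf (e₀ j)
  · rw [spectralParam_eq_of_blockOf_eq s h, mul_comm]
  · have h1 : restrictTo (offBlocks e₀)ᶜ R (i, j) = 0 :=
      Set.indicator_of_notMem (Set.notMem_compl_iff.2 h) R
    have h2 : restrictTo (offBlocks e₀)ᶜ R (j, i) = 0 :=
      Set.indicator_of_notMem (Set.notMem_compl_iff.2 (Ne.symm h)) R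
    have h3 : skewOfReal (restrictTo (offBlocks e₀)ᶜ R) i j = 0 := by
      rw [skewOfReal_apply, h1, h2]; apply Complex.ext <;> simp
    rw [h3, zero_mul, mul_zero]

theorem cayley_mul_comm {m : Type*} [Fintype m] [DecidableEq m] {H D : Matrix m m ℂ}
    (hH : Hᴴ = -H) (hD : H * D = D * H) : cayley H * D = D * cayley H := by
  have h1 := isUnit_det_one_add_of_skew hH
  have h2 : (1 + H) * D = D * (1 + H) := by
    rw [Matrix.add_mul, Matrix.mul_add, hD, Matrix.one_mul, Matrix.mul_one]
  have h3 : (1 - H) * D = D * (1 - H) := by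
    rw [Matrix.sub_mul, Matrix.mul_sub, hD, Matrix.one_mul, Matrix.mul_one]
  have h4 : (1 + H)⁻¹ * D = D * (1 + H)⁻¹ := by
    calc (1 + H)⁻¹ * D = (1 + H)⁻¹ * (D * (1 + H)) * (1 + H)⁻¹ := by
          rw [Matrix.mul_assoc, Matrix.mul_assoc, Matrix.mul_nonsing_inv _ h1, Matrix.mul_one]
      _ = D * (1 + H)⁻¹ := by
          rw [← h2, ← Matrix.mul_assoc, Matrix.nonsing_inv_mul _ h1, Matrix.one_mul]
  rw [cayley, Matrix.mul_assoc, h4, ← Matrix.mul_assoc, h3, Matrix.mul_assoc]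

/-- The factor inside the blocks commutes with D(s) and cancels against its inverse, leaving only
the factor off the blocks. -/
theorem eventually_exists_productParam_eq (s : Fin p → ℝ) :
    ∀ᶠ R : Fin n × Fin n → ℝ in nhds 0, ∃ x, cayley (skewOfReal R) * eigenvalueMatrix e₀ s *
      cayley (-skewOfReal R) = productParam e₀ x := by
  filter_upwards [eventually_exists_cayley_eq_mul (offBlocks e₀)] with R ⟨R', hR⟩
  refine ⟨Sum.elim (fun q => R' q) s, ?_⟩
  have hx : skewPart e₀ (Sum.elim (fun q => R' q) s) = skewOfReal (restrictTo (offBlocks e₀) R') := by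
    change skewOfReal _ = _
    congr 1
    ext q
    by_cases hq : q ∈ offBlocks e₀
    · exact (Subtype.val_injective.extend_apply (fun i : offBlocks e₀ => R' i) 0 ⟨q, hq⟩).trans
        (Set.indicator_of_mem hq R').symm
    · exact (Function.extend_apply' _ _ _ (by rintro ⟨i, rfl⟩; exact hq i.2)).trans
        (Set.indicator_of_notMem hq R').symm
  set K := skewOfReal (restrictTo (offBlocks e₀)ᶜ R') with hK
  have hKs : Kᴴ = -K := conjTranspose_skewOfReal _
  have hD := cayley_mul_comm hKs (skewOfReal_restrictTo_compl_mul_eigenvalueMatrix e₀ R' s)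
  rw [productParam, hx, ← conjTranspose_cayley (conjTranspose_skewOfReal R), hR,
    ← conjTranspose_cayley (conjTranspose_skewOfReal _), Matrix.conjTranspose_mul,
    conjTranspose_cayley hKs]
  set W := cayley (skewOfReal (restrictTo (offBlocks e₀) R'))
  calc _ = W * (cayley K * eigenvalueMatrix e₀ s) * cayley (-K) * Wᴴ := by
        simp only [Matrix.mul_assoc]
    _ = W * eigenvalueMatrix e₀ s * (cayley K * cayley (-K)) * Wᴴ := by
        rw [hD]; simp only [Matrix.mul_assoc]
    _ = _ := by rw [cayley_mul_cayley_neg hKs, Matrix.mul_one]; rfl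

theorem eval_eq_zero_of_productParam
    {P : MvPolynomial ((Fin n × Fin n) ⊕ (Fin n × Fin n)) ℝ}
    (hP : ∀ x, MvPolynomial.eval (realCoords (productParam e₀ x)) P = 0)
    {Z : Matrix (Fin n) (Fin n) ℂ} (hZ : Z ∈ grassmannianProduct (p + a) p n) :
    MvPolynomial.eval (realCoords Z) P = 0 := by
  obtain ⟨X, hX, Y, hY, rfl⟩ := hZ
  obtain ⟨U, hU, s, hs⟩ := exists_unitary_eq_of_mul e₀ hX hY
  -- The phase c disappears under conjugation, so U may be taken to be a Cayley transform.
  obtain ⟨c, hc, H, hH, hcU⟩ := exists_smul_eq_cayley hU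
  have e : X * Y = cayley (skewOfReal (realOfSkew H)) * eigenvalueMatrix e₀ s *
      cayley (-skewOfReal (realOfSkew H)) := by
    rw [skewOfReal_realOfSkew hH, ← conjTranspose_cayley hH, ← hcU, hs,
      Matrix.conjTranspose_smul, Matrix.smul_mul, Matrix.smul_mul, Matrix.mul_smul, smul_smul,
      hc, one_smul]
    rfl
  rw [e]
  have hreg : IsRegularFun fun R : Fin n × Fin n → ℝ => MvPolynomial.eval (realCoords
      (cayley (skewOfReal R) * eigenvalueMatrix e₀ s * cayley (-skewOfReal R))) P :=
    IsRegularFun.eval (fun i => isRegularFun_realCoords (isRegularMatrixFun_conj e₀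
      (isRegularMatrixFun_skewOfReal fun q => .coord q) conjTranspose_skewOfReal
      fun j => .const (s j)) i) P
  refine hreg.eq_zero_of_eventually (x := 0) ?_ (realOfSkew H)
  filter_upwards [eventually_exists_productParam_eq e₀ s] with R ⟨x, hx⟩
  rw [hx, hP]

end Parametrization

/-! ### The parametrization is an immersion at a generic point -/

section Immersion

variable {n p a b : ℕ} (e₀ : Fin n ≃ SpectralIndex p a b)

noncomputable instance : Fintype (offBlocks e₀) := Fintype.ofFinite _

/-- The point of the parameter space at which the derivative is computed. -/
noncomputable def basePoint : ParamIndex e₀ → ℝ := Sum.elim 0 genericParam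

theorem skewPart_basePoint : skewPart e₀ (basePoint e₀) = 0 := by
  have h : LinearMap.funLeft ℝ ℝ Sum.inl (basePoint e₀) = 0 := rfl
  rw [skewPart, LinearMap.comp_apply, LinearMap.comp_apply, h, map_zero, map_zero]

theorem skewPart_apply_eq_zero {v : ParamIndex e₀ → ℝ} {q : offBlocks e₀}
    (h : skewPart e₀ v q.1.1 q.1.2 = 0) : v (Sum.inl q) = 0 := by
  have h1 : Function.ExtendByZero.linearMap ℝ Subtype.val
      (LinearMap.funLeft ℝ ℝ Sum.inl v) q = v (Sum.inl q) :=
    Subtype.val_injective.extend_apply (fun i : offBlocks e₀ => v (Sum.inl i)) 0 q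
  have h2 := congrArg Complex.re h
  have h3 := congrArg Complex.im h
  simp only [skewPart, LinearMap.comp_apply, skewOfReal_apply, Prod.mk.eta, h1, Complex.zero_re,
    Complex.zero_im] at h2 h3
  linarith

theorem hasStrictFDerivAt_spectralParam (i : SpectralIndex p a b) :
    ∃ l : (ParamIndex e₀ → ℝ) →L[ℝ] ℝ,
      HasStrictFDerivAt (fun x : ParamIndex e₀ → ℝ => spectralParam (x ∘ Sum.inr) i) l
        (basePoint e₀) ∧ ∀ j, i = Sum.inl (Sum.inl j) → ∀ v, l v = v (Sum.inr j) := by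
  rcases i with (i | i) | (i | i)
  · refine ⟨_, ContinuousLinearMap.hasStrictFDerivAt
      (ContinuousLinearMap.proj (R := ℝ) (φ := fun _ : ParamIndex e₀ => ℝ) (Sum.inr i)), ?_⟩
    rintro j h v
    cases h
    rfl
  · exact ⟨_, (ContinuousLinearMap.hasStrictFDerivAt
      (ContinuousLinearMap.proj (R := ℝ) (φ := fun _ : ParamIndex e₀ => ℝ) (Sum.inr i))).neg,
      fun j h => by simp at h⟩
  · exact ⟨0, hasStrictFDerivAt_const _ _, fun j h => by simp at h⟩
  · exact ⟨0, hasStrictFDerivAt_const _ _, fun j h => by simp at h⟩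

/-- The speed of `circleParam` never vanishes, so the diagonal entries of the upper half plane
recover the velocities of the parameters. -/
theorem exists_hasStrictFDerivAt_eigenvalueMatrix :
    ∃ Δ : (ParamIndex e₀ → ℝ) →L[ℝ] Matrix (Fin n) (Fin n) ℂ,
      HasStrictFDerivAt (fun x : ParamIndex e₀ → ℝ => eigenvalueMatrix e₀ (x ∘ Sum.inr)) Δ
        (basePoint e₀) ∧ (∀ v i j, i ≠ j → Δ v i j = 0) ∧
        ∀ v, (∀ i, Δ v i i = 0) → ∀ j, v (Sum.inr j) = 0 := by
  choose l hl hl2 using fun i => hasStrictFDerivAt_spectralParam e₀ (e₀ i)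
  choose c hc0 hc using fun i : Fin n => exists_hasStrictDerivAt_circleParam
    (spectralParam (basePoint e₀ ∘ Sum.inr) (e₀ i))
  have h1 : HasStrictFDerivAt
      (fun (x : ParamIndex e₀ → ℝ) i => circleParam (spectralParam (x ∘ Sum.inr) (e₀ i)))
      (ContinuousLinearMap.pi fun i => (ContinuousLinearMap.toSpanSingleton ℝ (c i)).comp (l i))
      (basePoint e₀) :=
    hasStrictFDerivAt_pi.2 fun i => (hc i).hasStrictFDerivAt.comp (basePoint e₀) (hl i)
  let dg : (Fin n → ℂ) →L[ℝ] Matrix (Fin n) (Fin n) ℂ :=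
    LinearMap.toContinuousLinearMap (Matrix.diagonalLinearMap (Fin n) ℝ ℂ)
  refine ⟨_, dg.hasStrictFDerivAt.comp (basePoint e₀) h1, ?_, ?_⟩
  · intro v i j hij
    exact Matrix.diagonal_apply_ne (fun i => l i v • c i) hij
  · intro v hv j
    have h : Matrix.diagonal (fun i => l i v • c i) (e₀.symm (Sum.inl (Sum.inl j)))
      (e₀.symm (Sum.inl (Sum.inl j))) = 0 := hv _
    rw [Matrix.diagonal_apply_eq, smul_eq_zero] at h
    rw [← hl2 _ j (e₀.apply_symm_apply _) v]
    exact h.resolve_right (hc0 _)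

/-- The derivative is 2(D h(v) - h(v) D) + Δ v. Off the blocks its entries are 2(λᵢ - λⱼ) h(v)ᵢⱼ
with λᵢ ≠ λⱼ; on the diagonal it is Δ v. -/
theorem exists_hasStrictFDerivAt_productParam :
    ∃ T : (ParamIndex e₀ → ℝ) →L[ℝ] Matrix (Fin n) (Fin n) ℂ,
      HasStrictFDerivAt (productParam e₀) T (basePoint e₀) ∧ Function.Injective T := by
  obtain ⟨Δ, hΔ, hΔ1, hΔ2⟩ := exists_hasStrictFDerivAt_eigenvalueMatrix e₀
  let h : (ParamIndex e₀ → ℝ) →L[ℝ] Matrix (Fin n) (Fin n) ℂ :=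
    LinearMap.toContinuousLinearMap (skewPart e₀)
  have hh0 : h (basePoint e₀) = 0 := skewPart_basePoint e₀
  have hcay := hasStrictFDerivAt_cayley (m := Fin n) 0 (by simp) (c := -2) (by simp)
  rw [zero_smul] at hcay
  have hc1 : HasStrictFDerivAt (fun x => cayley (h x)) ((-2 : ℝ) • h) (basePoint e₀) := by
    have h0 := hcay
    rw [← hh0] at h0
    exact (h0.comp _ h.hasStrictFDerivAt).congr_fderiv (by ext1 v; rfl)
  have hc2 : HasStrictFDerivAt (fun x => cayley (-h x)) ((2 : ℝ) • h) (basePoint e₀) := by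
    have h0 := hcay
    have hh1 : (-h) (basePoint e₀) = 0 := by
      change -h (basePoint e₀) = 0
      rw [hh0, neg_zero]
    rw [← hh1] at h0
    refine (h0.comp _ (-h).hasStrictFDerivAt).congr_fderiv ?_
    ext1 v
    change (-2 : ℝ) • (-h v) = (2 : ℝ) • h v
    rw [smul_neg, neg_smul, neg_neg]
  set D := eigenvalueMatrix e₀ (basePoint e₀ ∘ Sum.inr) with hD
  obtain ⟨T, hT, hTv⟩ : ∃ T : (ParamIndex e₀ → ℝ) →L[ℝ] Matrix (Fin n) (Fin n) ℂ,
      HasStrictFDerivAt (productParam e₀) T (basePoint e₀) ∧ ∀ v, T v =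
        cayley (h (basePoint e₀)) * D * ((2 : ℝ) • h v) +
          (cayley (h (basePoint e₀)) * Δ v + ((-2 : ℝ) • h v) * D) *
            cayley (-h (basePoint e₀)) :=
    ⟨_, (hc1.mul' hΔ).mul' hc2, fun v => rfl⟩
  refine ⟨T, hT, (injective_iff_map_eq_zero T).2 fun v hv => ?_⟩
  have hc0 : cayley (0 : Matrix (Fin n) (Fin n) ℂ) = 1 := by
    rw [cayley, sub_zero, add_zero, inv_one, Matrix.one_mul]
  simp only [hh0, neg_zero, hc0, Matrix.one_mul, Matrix.mul_one] at hTv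
  have hv' := (hTv v).symm.trans hv
  have hentry : ∀ i j, 2 * (circleParam (spectralParam genericParam (e₀ i)) -
      circleParam (spectralParam genericParam (e₀ j))) * h v i j + Δ v i j = 0 := by
    intro i j
    have h1 := congrFun (congrFun hv' i) j
    have h2 : (D * ((2 : ℝ) • h v)) i j =
        circleParam (spectralParam genericParam (e₀ i)) * (2 * h v i j) := by
      rw [hD, eigenvalueMatrix, Matrix.diagonal_mul]
      simp [basePoint, Matrix.smul_apply]
    have h3 : (((-2 : ℝ) • h v) * D) i j =
        (-2 * h v i j) * circleParam (spectralParam genericParam (e₀ j)) := by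
      rw [hD, eigenvalueMatrix, Matrix.mul_diagonal]
      simp [basePoint, Matrix.smul_apply]
    rw [Matrix.add_apply, Matrix.add_apply, h2, h3, Matrix.zero_apply] at h1
    linear_combination h1
  ext (q | j)
  · refine skewPart_apply_eq_zero e₀ ?_
    have h1 := hentry q.1.1 q.1.2
    have hne : q.1.1 ≠ q.1.2 := fun h2 => q.2 (by rw [h2])
    rw [hΔ1 _ _ _ hne, add_zero, mul_eq_zero] at h1
    exact h1.resolve_left
      (mul_ne_zero two_ne_zero (sub_ne_zero.2 (circleParam_genericParam_ne q.2)))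
  · refine hΔ2 v (fun i => ?_) j
    simpa using hentry i i

end Immersion

/-! ### The dimension -/

/-- The real coordinates of a complex matrix as a linear map. -/
def realCoordsLinearMap (n : ℕ) :
    Matrix (Fin n) (Fin n) ℂ →ₗ[ℝ] ((Fin n × Fin n) ⊕ (Fin n × Fin n) → ℝ) where
  toFun A := realCoords A
  map_add' A B := by ext (q | q) <;> simp [realCoords]
  map_smul' c A := by ext (q | q) <;> simp [realCoords]

theorem realCoordsLinearMap_injective (n : ℕ) : Function.Injective (realCoordsLinearMap n) := by
  intro A B h
  ext i j
  exact Complex.ext (congrFun h (Sum.inl (i, j))) (congrFun h (Sum.inr (i, j)))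

theorem realDim_grassmannianProduct {n p a b : ℕ} (e₀ : Fin n ≃ SpectralIndex p a b) :
    realDim (grassmannianProduct (p + a) p n) = Nat.card (ParamIndex e₀) := by
  obtain ⟨T, hT, hinj⟩ := exists_hasStrictFDerivAt_productParam e₀
  obtain ⟨l, hl⟩ := LinearMap.exists_leftInverse_of_injective
    ((realCoordsLinearMap n) ∘ₗ (T : (ParamIndex e₀ → ℝ) →ₗ[ℝ] Matrix (Fin n) (Fin n) ℂ))
    (LinearMap.ker_eq_bot.2 ((realCoordsLinearMap_injective n).comp hinj))
  -- The y j are the components of a linear left inverse of the derivative; composed with the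
  -- parametrization they have derivative 1, so they fill a neighbourhood on which any relation Q
  -- must vanish.
  let y : ParamIndex e₀ → MvPolynomial ((Fin n × Fin n) ⊕ (Fin n × Fin n)) ℝ := fun j =>
    ∑ i, MvPolynomial.C (l (Pi.single i 1) j) * MvPolynomial.X i
  have hy : ∀ x j, MvPolynomial.eval x (y j) = l x j := by
    intro x j
    have hsingle : ∀ i : (Fin n × Fin n) ⊕ (Fin n × Fin n),
        (fun j => if i = j then (1 : ℝ) else 0) = Pi.single i 1 := fun i => by
      ext j; simp only [Pi.single_apply, eq_comm (a := i)]
    rw [LinearMap.pi_apply_eq_sum_univ l x, Finset.sum_apply]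
    simp [y, hsingle, mul_comm]
  refine semialgebraicDim_eq_card (ψ := fun x => realCoords (productParam e₀ x)) ?_ ?_ ?_ y ?_
  · exact isRegularFun_realCoords (isRegularMatrixFun_conj e₀ (isRegularMatrixFun_skewPart e₀)
      (conjTranspose_skewPart e₀) fun j => .coord (Sum.inr j))
  · exact fun x => Set.mem_image_of_mem _ (productParam_mem e₀ x)
  · rintro P hP _ ⟨Z, hZ, rfl⟩
    exact eval_eq_zero_of_productParam e₀ hP hZ
  · intro Q hQ
    let L : Matrix (Fin n) (Fin n) ℂ →L[ℝ] (ParamIndex e₀ → ℝ) :=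
      LinearMap.toContinuousLinearMap (l ∘ₗ realCoordsLinearMap n)
    have hder : HasStrictFDerivAt (fun x => L (productParam e₀ x))
        (ContinuousLinearMap.id ℝ (ParamIndex e₀ → ℝ)) (basePoint e₀) :=
      (L.hasStrictFDerivAt.comp _ hT).congr_fderiv (by
        ext1 v
        exact LinearMap.congr_fun hl v)
    have hmap := hder.map_nhds_eq_of_surj (by
      rw [LinearMap.range_eq_top]; exact Function.surjective_id)
    refine MvPolynomial.eq_zero_of_eventually (x := L (productParam e₀ (basePoint e₀))) ?_
    rw [← hmap, Filter.eventually_map]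
    refine Filter.Eventually.of_forall fun x => ?_
    rw [← hQ x]
    congr 2
    ext j
    exact (hy _ j).symm

theorem theorem3p3 (n k k' : ℕ) (hk'k : k' ≤ k) (hkn : k < n) (hsum : k + k' ≤ n) :
    ∃ d : ℕ, realDim (grassmannianProduct k k' n) = (d : WithBot ℕ∞) ∧
      (d : ℤ) = 2 * (k : ℤ) * ((n : ℤ) - k) + 2 * (k' : ℤ) * ((n : ℤ) - k') - k' := by
  obtain ⟨a, rfl⟩ := Nat.exists_eq_add_of_le hk'k
  obtain ⟨b, rfl⟩ := Nat.exists_eq_add_of_le hsum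
  let e₀ : Fin (k' + a + k' + b) ≃ SpectralIndex k' a b :=
    Fintype.equivOfCardEq (by simp; ring)
  refine ⟨_, realDim_grassmannianProduct e₀, ?_⟩
  have h := card_offBlocks e₀
  rw [Nat.card_sum, Nat.card_eq_fintype_card (α := Fin k'), Fintype.card_fin]
  zify at h
  push_cast
  -- Here n = 2k' + a + b, and h gives n² - 2k' - a² - b² coordinates off the blocks besides the k'
  -- eigenvalue parameters.
  linear_combination h
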